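/- Let $G$ be a finite group. For a $G$-space $X$ and a subgroup $H\le G$ write $G_x$ for the isotropy group of $x\in X$, $X^H=\{x : H\le G_x\}$, $X_H=\{x : G_x=H\}$, and $\mathrm{Sing}(X^H)=\{x\in X^H : H\subsetneq G_x\}$. A map $f:X\to Y$ of $G$-spaces is isovariant if it is continuous, equivariant, and $G_{f(x)}=G_x$ for all $x$; $\mathrm{Map}_{\mathrm{isvt}}(X,Y)$ is the space of isovariant maps, a subspace of the space of continuous maps with the compact-open topology. For a strictly increasing chain $\mathbf H=(H_0<\dots<H_n)$ of subgroups of $G$, the linking simplex $\Delta^{\mathbf H}$ is the quotient of $G\times\Delta^n$ by $(g,x)\sim(g',x)$ whenever $x=(t_0,\dots,t_{n-k},0,\dots,0)$ and $gH_k=g'H_k$ for some $0\le k\le n$, with $G$ acting by left multiplication. $X$ has treelike isotropy structure if all its isotropy groups are normal in $G$ and, for each isotropy group $H$, the isotropy groups contained in $H$ are linearly ordered by inclusion. A mapping cylinder neighborhood of a closed set $S$ in a compact Hausdorff space $Z$ is a closed neighborhood $N$ of $S$, with boundary $\partial N$ (the frontier of $N$ in $Z$), together with a continuous map $c:\partial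 N\times[0,1]\to Z$ such that $c(b,1)=b$, $c(b,0)\in S$, and $c$ restricts to a bijection $\partial N\times(0,1]\to N\setminus S$; thus $N$ is identified with the mapping cylinder of $c(\cdot,0):\partial N\to S$. Suppose $N\subseteq X^H$ and $M\subseteq Y^H$ are mapping cylinder neighborhoods of $\mathrm{Sing}(X^H)$ and $\mathrm{Sing}(Y^H)$, with cylinder maps $c$ and $d$. A continuous map $g:\partial N\to\partial M$ is said to be induced by an isovariant map $f:X\to Y$ if there is $\varepsilon\in(0,1]$ such that $f(c(b,t))\in M\setminus \mathrm{Sing}(Y^H)$ for all $b\in\partial N$ and $0<t\le\varepsilon$, and such that for every $b\in\partial N$ there is $s\in(0,1]$ with $f(c(b,\varepsilon))=d(g(b),s)$. (For compact Hausdorff $X,Y$ such $g$ exists and is unique up to homotopy.) **Proposition.** Let $X$ and $Y$ be compact smooth $G$-manifolds (without boundary) with treelike isotropy structure, and let $f:X\to Y$ be an isovariant map such that for every subgroup $H\le G$ which is an isotropy group of $X$ or of $Y$: 1. $f^H:X^H\to Y^H$ is a homotopy equivalence; 2. $f_H:X_H\to Y_H$ is a homotopy equivalence; 3. for some mapping cylinder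 neighborhoods $N^H(X)$ of $\mathrm{Sing}(X^H)$ in $X^H$ and $N^H(Y)$ of $\mathrm{Sing}(Y^H)$ in $Y^H$, $f$ induces a homotopy equivalence $\partial N^H(X)\to\partial N^H(Y)$. Then $f$ is a weak equivalence in the geometric model structure on isovariant $G$-spaces; that is, for every strictly increasing chain $\mathbf H=(H_0<\dots<H_n)$ of subgroups of $G$, the map $$\mathrm{Map}_{\mathrm{isvt}}(\Delta^{\mathbf H},f):\mathrm{Map}_{\mathrm{isvt}}(\Delta^{\mathbf H},X)\to\mathrm{Map}_{\mathrm{isvt}}(\Delta^{\mathbf H},Y)$$ is a weak homotopy equivalence. -/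

import Mathlib

open Topology unitInterval
open scoped ContDiff Manifold

/-! ### Homotopy equivalences and weak homotopy equivalences -/

section Homotopy

variable {A B : Type*} [TopologicalSpace A] [TopologicalSpace B]

/-- A continuous map is a homotopy equivalence. -/
def IsHomotopyEquiv (f : C(A, B)) : Prop :=
  ∃ e : ContinuousMap.HomotopyEquiv A B, e.toFun = f

/-- The map induced on sets of path components. -/
def zerothHomotopyMap (f : C(A, B)) : ZerothHomotopy A → ZerothHomotopy B :=
  Quotient.map f fun _ _ h => h.map f.continuous

/-- The map induced on the `n`-th homotopy group (a set of path components for `n = 0`). -/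
def homotopyGroupMap (n : ℕ) (f : C(A, B)) (a : A) :
    HomotopyGroup.Pi n A a → HomotopyGroup.Pi n B (f a) :=
  Quotient.map
    (fun p : GenLoop (Fin n) A a =>
      (⟨f.comp p.1, fun y hy => congrArg f (p.2 y hy)⟩ : GenLoop (Fin n) B (f a)))
    fun _ _ h => ContinuousMap.HomotopicRel.comp_continuousMap h f

/-- A weak homotopy equivalence: a bijection on path components which induces bijections
(hence isomorphisms) on all homotopy groups at all base points. -/
def IsWeakHomotopyEquiv (f : C(A, B)) : Prop :=
  Function.Bijective (zerothHomotopyMap f) ∧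
    ∀ (n : ℕ) (a : A), Function.Bijective (homotopyGroupMap n f a)

end Homotopy

/-! ### Mapping cylinder neighborhoods -/

/-- A mapping cylinder neighborhood of `S` in `Z`: a closed neighborhood `N` of `S` together with
a map `cyl : ∂N × [0,1] → Z` on its boundary `∂N` (the frontier of `N`), which exhibits `N` as the
mapping cylinder of `cyl (·, 0) : ∂N → S`, with `∂N` as the free end `t = 1` of the cylinder and
`S` as its base `t = 0`.  It is used for `Z` compact Hausdorff and `S` closed; the
continuous bijection from the mapping cylinder of `cyl (·, 0)` onto `N` is then automatically a
homeomorphism. -/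
structure MappingCylinderNhd {Z : Type*} [TopologicalSpace Z] (S : Set Z) where
  /-- the neighborhood `N` -/
  carrier : Set Z
  isClosed_carrier : IsClosed carrier
  subset_interior : S ⊆ interior carrier
  /-- the cylinder coordinates on `N` -/
  cyl : C(frontier carrier × I, Z)
  cyl_one : ∀ b, cyl (b, 1) = b
  cyl_zero_mem : ∀ b, cyl (b, 0) ∈ S
  injOn_cyl : Set.InjOn cyl {p | 0 < p.2}
  image_cyl : cyl '' {p | 0 < p.2} = carrier \ S

/-- The boundary `∂N` of a mapping cylinder neighborhood `N`. -/
abbrev MappingCylinderNhd.Boundary {Z : Type*} [TopologicalSpace Z] {S : Set Z}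
    (N : MappingCylinderNhd S) : Type _ :=
  frontier N.carrier

/-- `g : ∂N → ∂M` is a map induced by `φ : Z → W`: push `∂N` towards `S` along the cylinder lines
to a level `ε > 0` such that `φ` carries the part of `N \ S` up to this level into `M \ T`; apply
`φ`; and project to `∂M` along the cylinder lines of `M`.  (When `φ⁻¹(T) = S`, such `ε` exist if
`Z` is compact Hausdorff, and different choices of `ε` give homotopic maps.) -/
def MappingCylinderNhd.InducedOnBoundary {Z W : Type*} [TopologicalSpace Z] [TopologicalSpace W]
    {S : Set Z} {T : Set W} (N : MappingCylinderNhd S) (M : MappingCylinderNhd T) (φ : C(Z, W))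
    (g : C(N.Boundary, M.Boundary)) : Prop :=
  ∃ ε : I, 0 < ε ∧
    (∀ (b : N.Boundary) (t : I), 0 < t → t ≤ ε → φ (N.cyl (b, t)) ∈ M.carrier \ T) ∧
    ∀ b : N.Boundary, ∃ s : I, 0 < s ∧ φ (N.cyl (b, ε)) = M.cyl (g b, s)

/-! ### Isovariant maps -/

section Isovariant

variable (G : Type*) [Group G]

/-- An isovariant map of `G`-spaces: a continuous equivariant map which strictly preserves
isotropy groups. -/
structure IsovariantMap (X Y : Type*) [TopologicalSpace X] [TopologicalSpace Y]
    [MulAction G X] [MulAction G Y] where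
  toContinuousMap : C(X, Y)
  map_smul : ∀ (g : G) (x : X), toContinuousMap (g • x) = g • toContinuousMap x
  stabilizer_map : ∀ x : X,
    MulAction.stabilizer G (toContinuousMap x) = MulAction.stabilizer G x

/-- The space of isovariant maps is topologized as a subspace of the space of continuous maps
(with the compact-open topology). -/
instance IsovariantMap.instTopologicalSpace (X Y : Type*) [TopologicalSpace X]
    [TopologicalSpace Y] [MulAction G X] [MulAction G Y] :
    TopologicalSpace (IsovariantMap G X Y) :=
  TopologicalSpace.induced IsovariantMap.toContinuousMap inferInstance

variable {G} {X Y : Type*} [TopologicalSpace X] [TopologicalSpace Y]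
  [MulAction G X] [MulAction G Y]

/-- Postcomposition with an isovariant map `f : X → Y`, as a continuous map from the space of
isovariant maps `D → X` to the space of isovariant maps `D → Y`. -/
def IsovariantMap.postcomp (D : Type*) [TopologicalSpace D] [MulAction G D]
    (f : IsovariantMap G X Y) : C(IsovariantMap G D X, IsovariantMap G D Y) where
  toFun φ :=
    { toContinuousMap := f.toContinuousMap.comp φ.toContinuousMap
      map_smul := fun g x => by
        simp [φ.map_smul, f.map_smul]
      stabilizer_map := fun x => by
        simp [φ.stabilizer_map, f.stabilizer_map] }
  continuous_toFun := continuous_induced_rng.2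
    ((ContinuousMap.continuous_postcomp f.toContinuousMap).comp continuous_induced_dom)

variable (G X) in
/-- `H` occurs as the isotropy group of a point of `X`. -/
def IsIsotropyGroup (H : Subgroup G) : Prop :=
  ∃ x : X, MulAction.stabilizer G x = H

variable (G X) in
/-- Treelike isotropy structure: all isotropy groups are normal, and the isotropy groups contained
in a given isotropy group are linearly ordered by inclusion. -/
def HasTreelikeIsotropy : Prop :=
  ∀ H : Subgroup G, IsIsotropyGroup G X H →
    H.Normal ∧ IsChain (· ≤ ·) {K : Subgroup G | IsIsotropyGroup G X K ∧ K ≤ H}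

variable (X) in
/-- The stratum `X_H` of points with isotropy group exactly `H`. -/
def stratum (H : Subgroup G) : Set X :=
  {x | MulAction.stabilizer G x = H}

variable (X) in
/-- The singular set of `X^H`: the points whose isotropy groups are strictly larger than `H`. -/
def singularSet (H : Subgroup G) : Set (MulAction.fixedPoints H X) :=
  {x | H < MulAction.stabilizer G (x : X)}

/-- The map `f^H : X^H → Y^H`. -/
def IsovariantMap.onFixedPoints (f : IsovariantMap G X Y) (H : Subgroup G) :
    C(MulAction.fixedPoints H X, MulAction.fixedPoints H Y) where
  toFun x := ⟨f.toContinuousMap x, fun h => by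
    have hx : (h : G) • (x : X) = x := x.2 h
    change (h : G) • f.toContinuousMap x = f.toContinuousMap x
    rw [← f.map_smul, hx]⟩
  continuous_toFun := by fun_prop

/-- The map `f_H : X_H → Y_H`. -/
def IsovariantMap.onStratum (f : IsovariantMap G X Y) (H : Subgroup G) :
    C(stratum X H, stratum Y H) where
  toFun x := ⟨f.toContinuousMap x, (f.stabilizer_map x).trans x.2⟩
  continuous_toFun := by fun_prop

/-- The Dula-Schultz conditions on an isovariant map `f : X → Y`: for every isotropy group `H`
(of `X` or of `Y`), `f` induces homotopy equivalences `X^H → Y^H`, `X_H → Y_H` and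
`∂N^H(X) → ∂N^H(Y)`, where `N^H(X)` is a mapping cylinder neighborhood of the singular set of
`X^H`. -/
structure IsovariantMap.DulaSchultzConditions (f : IsovariantMap G X Y) : Prop where
  fixedPoints : ∀ H : Subgroup G, IsIsotropyGroup G X H ∨ IsIsotropyGroup G Y H →
    IsHomotopyEquiv (f.onFixedPoints H)
  stratum : ∀ H : Subgroup G, IsIsotropyGroup G X H ∨ IsIsotropyGroup G Y H →
    IsHomotopyEquiv (f.onStratum H)
  boundary : ∀ H : Subgroup G, IsIsotropyGroup G X H ∨ IsIsotropyGroup G Y H →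
    ∃ (N : MappingCylinderNhd (singularSet X H)) (M : MappingCylinderNhd (singularSet Y H))
      (g : C(N.Boundary, M.Boundary)),
      N.InducedOnBoundary M (f.onFixedPoints H) g ∧ IsHomotopyEquiv g

end Isovariant

/-! ### Linking simplices and isovariant weak equivalences -/

section Linking

variable {G : Type*} [Group G]

/-- For a chain `H₀ < ⋯ < Hₙ` of subgroups, the relation on `G × Δⁿ` identifying `(g, x)` with
`(g', x)` when `x = (t₀, …, tₙ₋ₖ, 0, …, 0)` and `g Hₖ = g' Hₖ` for some `k`. -/
def linkingSetoid (H : LTSeries (Subgroup G)) :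
    Setoid (G × stdSimplex ℝ (Fin (H.length + 1))) where
  r p q := p.2 = q.2 ∧ ∃ k : Fin (H.length + 1),
    (∀ i : Fin (H.length + 1), H.length < (i : ℕ) + k → (p.2 : Fin (H.length + 1) → ℝ) i = 0) ∧
      p.1⁻¹ * q.1 ∈ H k
  iseqv :=
    { refl := fun p => ⟨rfl, 0, fun i hi => by
        have := i.2
        simp only [Fin.val_zero] at hi
        omega, by simp⟩
      symm := by
        rintro p q ⟨h, k, hk, hg⟩
        exact ⟨h.symm, k, fun i hi => h ▸ hk i hi, by simpa using inv_mem hg⟩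
      trans := by
        rintro p q r ⟨h, k, hk, hg⟩ ⟨h', l, hl, hg'⟩
        have key : p.1⁻¹ * r.1 = (p.1⁻¹ * q.1) * (q.1⁻¹ * r.1) := by group
        rcases le_total k l with hkl | hkl
        · exact ⟨h.trans h', l, fun i hi => h ▸ hl i hi,
            key ▸ mul_mem (H.monotone hkl hg) hg'⟩
        · exact ⟨h.trans h', k, hk, key ▸ mul_mem hg (H.monotone hkl hg')⟩ }

/-- The linking simplex of a chain of subgroups of `G`, with the quotient topology once `G` carries
a topology. -/
def LinkingSimplex (H : LTSeries (Subgroup G)) : Type _ :=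
  Quotient (linkingSetoid H)

instance LinkingSimplex.instTopologicalSpace [TopologicalSpace G] (H : LTSeries (Subgroup G)) :
    TopologicalSpace (LinkingSimplex H) :=
  inferInstanceAs (TopologicalSpace (Quotient (linkingSetoid H)))

instance LinkingSimplex.instMulAction (H : LTSeries (Subgroup G)) :
    MulAction G (LinkingSimplex H) where
  smul g := Quotient.map (fun p => (g * p.1, p.2)) (by
    rintro p q ⟨h, k, hk, hg⟩
    exact ⟨h, k, hk, by simpa [mul_assoc] using hg⟩)
  one_smul := by
    rintro ⟨p⟩
    exact congrArg (Quotient.mk _) (Prod.ext (one_mul _) rfl)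
  mul_smul := by
    rintro g g' ⟨p⟩
    exact congrArg (Quotient.mk _) (Prod.ext (mul_assoc _ _ _) rfl)

/-- The weak equivalences between `G`-spaces in the geometric model structure: isovariant maps which
induce weak homotopy equivalences on the spaces of isovariant maps out of all linking simplices. -/
def IsovariantMap.IsWeakEquivalence [TopologicalSpace G] {X Y : Type*} [TopologicalSpace X]
    [TopologicalSpace Y] [MulAction G X] [MulAction G Y] (f : IsovariantMap G X Y) : Prop :=
  ∀ H : LTSeries (Subgroup G), IsWeakHomotopyEquiv (f.postcomp (LinkingSimplex H))

end Linking

/-!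
The proof shows that `f` has the homotopy extension and lifting property (`HasHELP`) on spaces of
isovariant maps out of linking simplices: a family of maps to `Y`, parametrized by a compact
Hausdorff space, whose restriction to a cofibration is lifted to `X`, lifts to `X` up to a homotopy
relative to the cofibration. Applied to cubes and their boundaries, this gives a weak homotopy
equivalence (`HasHELP.isWeakHomotopyEquiv`). Homotopy equivalences have this property
(`IsMappingPathFull.hasHELP`). The detour through fundamental groupoids of mapping spaces
(`IsMappingPathFull`) makes it easy to pass to composites and to cancel a factor.

An isovariant map out of the linking simplex of `H₀ < ⋯ < Hₙ` is determined by its restriction to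
the simplex, which is a map with prescribed isotropy groups. As the simplex is a retract of a cube,
compatibly with the vanishing of coordinates, one may use instead the maps `γ : Iⁿ → X` for which
the isotropy group of `γ v` is `Hₖ`, for the first `k` with `v k ≠ 0`, and `Hₙ` at `v = 0`
(`cubeMaps`). These are treated by induction on `n`. For `n = 0` they are the points of the stratum
`X_{H₀}`. In general, let `K ≤ H₁` be minimal among the isotropy groups which are larger than `H₀`.
A map as above amounts to its restriction to the face `v 0 = 0`, which has values in `X^K`, and a
family, parametrized by that face, of paths which start in `X^K` and are otherwise contained in the
stratum of `H₀`, lying over this restriction. The induction step rests on two facts about the space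
of these exit paths.

* The initial point is a regular fibration from exit paths to `X^K` (`isRegularFibration_initial`):
  in a chart around a point of `X^K` in which `K` acts linearly, the translations in the directions
  of `X^K` preserve the stratum of `H₀`. This uses that there are no isotropy groups strictly
  between `H₀` and `K`, and that the isotropy structure is treelike.
* On exit paths, `f` has the homotopy extension and lifting property
  (`IsovariantMap.DulaSchultzConditions.hasHELP_onExitPaths`). The paths in `X^{H₀}` which leave the
  singular set at once form a space which is homotopy equivalent to the boundary of a mapping
  cylinder neighborhood, at least as seen by compact parameter spaces
  (`MappingCylinderNhd.hasHELP_exitPaths`). Since the isotropy structure is treelike, `X^K` is open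
  and closed in the singular set, so that one may restrict to the paths which start in `X^K`.

Given solutions of the lifting problem for the restriction to the face (by induction), for exit
paths, and for `X^K`, the fibrations allow one to solve the problem for exit paths over the given
solution on the face (`HasHELP.exists_lift_over`).
-/

/-! ### Cofibrations -/

section Cofibration

/-- A closed cofibration `A ⊆ P`, in terms of a retraction of `P × I` onto
`P × {0} ∪ A × I`. -/
structure IsCofib {P : Type*} [TopologicalSpace P] (A : Set P) : Prop where
  isClosed : IsClosed A
  exists_retraction : ∃ r : C(P × I, P × I), (∀ p, r (p, 0) = (p, 0)) ∧
    (∀ p ∈ A, ∀ t, r (p, t) = (p, t)) ∧ ∀ z, (r z).2 = 0 ∨ (r z).1 ∈ A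

variable {P Q Y : Type*} [TopologicalSpace P] [TopologicalSpace Q] [TopologicalSpace Y] {A : Set P}

/-- The homotopy extension property. -/
theorem IsCofib.extend (hA : IsCofib A) (u : C(P, Y)) (w : C(A × I, Y))
    (h : ∀ a : A, w (a, 0) = u a) :
    ∃ F : C(P × I, Y), (∀ p, F (p, 0) = u p) ∧ ∀ (a : A) t, F (a, t) = w (a, t) := by
  classical
  obtain ⟨hc, r, h0, h1, h2⟩ := hA
  let g : P × I → Y := fun z => if hz : z.1 ∈ A then w (⟨z.1, hz⟩, z.2) else u z.1
  have g1 : ∀ (a : A) t, g (a, t) = w (a, t) := fun a t => by simp [g]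
  have g0 : ∀ p, g (p, 0) = u p := fun p => by
    by_cases hp : p ∈ A
    · simpa [g, hp] using h ⟨p, hp⟩
    · simp [g, hp]
  have c1 : ContinuousOn g {z : P × I | z.1 ∈ A} := by
    rw [continuousOn_iff_continuous_domRestrict]
    have : Set.domRestrict {z : P × I | z.1 ∈ A} g =
        fun z => w (⟨z.1.1, z.2⟩, z.1.2) := by
      ext z
      exact g1 ⟨z.1.1, z.2⟩ z.1.2
    rw [this]
    fun_prop
  have c0 : ContinuousOn g {z : P × I | z.2 = 0} := by
    refine (u.continuous.comp continuous_fst).continuousOn.congr ?_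
    rintro ⟨p, t⟩ (rfl : t = 0)
    exact g0 p
  have cg := ContinuousOn.union_of_isClosed c0 c1
    (isClosed_eq continuous_snd continuous_const) (hc.preimage continuous_fst)
  refine ⟨⟨fun z => g (r z), cg.comp_continuous r.continuous h2⟩, fun p => ?_, fun a t => ?_⟩
  · simp [h0, g0]
  · simp [h1 a a.2, g1]

theorem IsCofib.empty : IsCofib (∅ : Set P) :=
  ⟨isClosed_empty, ⟨fun z => (z.1, 0), by fun_prop⟩, by simp, by simp, by simp⟩

theorem IsCofib.prod_right (hA : IsCofib A) :
    IsCofib {z : P × Q | z.1 ∈ A} := by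
  obtain ⟨hc, r, h0, h1, h2⟩ := hA
  refine ⟨hc.preimage continuous_fst,
    ⟨fun z => (((r (z.1.1, z.2)).1, z.1.2), (r (z.1.1, z.2)).2), by fun_prop⟩, ?_, ?_, ?_⟩
  · simp [h0]
  · rintro ⟨p, q⟩ hp t
    simp [h1 p hp]
  · rintro ⟨⟨p, q⟩, t⟩
    exact h2 (p, t)

theorem IsCofib.preimage_homeomorph (hA : IsCofib A) (e : Q ≃ₜ P) : IsCofib (e ⁻¹' A) := by
  obtain ⟨hc, r, h0, h1, h2⟩ := hA
  refine ⟨hc.preimage e.continuous,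
    ⟨fun z => (e.symm (r (e z.1, z.2)).1, (r (e z.1, z.2)).2), by fun_prop⟩, ?_, ?_, ?_⟩
  · simp [h0]
  · rintro q hq t
    simp [h1 _ hq]
  · rintro ⟨q, t⟩
    simpa using h2 (e q, t)

/-- The part `P × {0, 1} ∪ A × I` of the boundary of the cylinder `P × I`. -/
def cylBdry (A : Set P) : Set (P × I) := {z | z.2 = 0 ∨ z.2 = 1 ∨ z.1 ∈ A}

/-- If `A ⊆ P` is a cofibration, then so is `P × {0, 1} ∪ A × I ⊆ P × I`. -/
theorem IsCofib.cylBdry (hA : IsCofib A) : IsCofib (cylBdry A) := by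
  obtain ⟨hc, r, h0, h1, h2⟩ := hA
  -- The point `(2 t - 1, s)` of `[-1, 1] × [0, 1]` is projected from `(0, 2)` to the point
  -- `(a t s, b t s)` of `[-1, 1] × {0} ∪ {-1, 1} × [0, 1]`; its position on the segment from
  -- this point to `(0, 2)` is `l t s`.
  let P01 : ℝ → I := Set.projIcc (0 : ℝ) 1 zero_le_one
  have hP : Continuous P01 := continuous_projIcc
  have hPv : ∀ x : I, P01 x = x := fun x => Set.projIcc_val _ x
  let a : I × I → ℝ := fun x => max (-1) (min 1 (2 * (2 * (x.1 : ℝ) - 1) / (2 - x.2)))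
  let b : I × I → ℝ := fun x =>
    max 0 (2 * |2 * (x.1 : ℝ) - 1| - 2 + x.2) / max |2 * (x.1 : ℝ) - 1| (1 / 2)
  let l : I × I → ℝ := fun x => (x.2 - b x) / (2 - b x)
  have hs2 : ∀ s : I, (0 : ℝ) < 2 - s := fun s => by linarith [s.2.2]
  have hbs : ∀ x, b x ≤ x.2 := fun x => by
    have hm : (0 : ℝ) < max |2 * (x.1 : ℝ) - 1| (1 / 2) := lt_max_of_lt_right (by norm_num)
    rw [div_le_iff₀ hm]
    refine max_le (mul_nonneg x.2.2.1 hm.le) ?_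
    have h1 : |2 * (x.1 : ℝ) - 1| ≤ 1 := abs_le.2 ⟨by linarith [x.1.2.1], by linarith [x.1.2.2]⟩
    have := mul_le_mul_of_nonneg_left (le_max_left |2 * (x.1 : ℝ) - 1| (1 / 2)) x.2.2.1
    nlinarith [x.2.2.2]
  have hb0 : ∀ x, 0 ≤ b x := fun x => by positivity
  have hb2 : ∀ x, (0 : ℝ) < 2 - b x := fun x => by linarith [hbs x, x.2.2.2]
  have ha : Continuous a := by
    refine continuous_const.max (continuous_const.min (Continuous.div (by fun_prop) (by fun_prop) ?_))
    exact fun x => (hs2 x.2).ne'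
  have hb : Continuous b := by
    refine Continuous.div (by fun_prop) (by fun_prop) fun x => ?_
    exact (lt_max_of_lt_right (by norm_num)).ne'
  have hl : Continuous l := Continuous.div (by fun_prop) (by fun_prop) fun x => (hb2 x).ne'
  have hl0 : ∀ x, 0 ≤ l x := fun x => div_nonneg (by linarith [hbs x]) (hb2 x).le
  have hl1 : ∀ x, l x ≤ 1 := fun x => by
    rw [div_le_one (hb2 x)]
    linarith [x.2.2.2]
  have key : ∀ x : I × I, b x + l x * (2 - b x) = x.2 := fun x => by
    have := (hb2 x).ne'
    simp only [l]
    field_simp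
    ring
  have hlb : ∀ x : I × I, 1 - l x = (2 - x.2) / (2 - b x) := fun x => by
    have := (hb2 x).ne'
    simp only [l]
    field_simp
    ring
  have cases : ∀ x : I × I, (b x = 0 ∧ a x * (1 - l x) = 2 * x.1 - 1) ∨
      ((a x = 1 ∨ a x = -1) ∧ a x * (1 - l x) = 2 * x.1 - 1) := fun x => by
    rw [hlb]
    have h2 := hs2 x.2
    have h2' := h2.ne'
    set z : ℝ := 2 * (x.1 : ℝ) - 1 with hz
    rcases le_or_gt (2 * |z| - 2 + x.2) 0 with hle | hgt
    · left
      have hb : b x = 0 := by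
        show max 0 (2 * |z| - 2 + x.2) / _ = 0
        rw [max_eq_left hle, zero_div]
      have hza := abs_le.1 (show |z| ≤ (2 - x.2) / 2 by linarith)
      have haz : a x = 2 * z / (2 - x.2) := by
        show max (-1) (min 1 (2 * z / (2 - x.2))) = _
        rw [min_eq_right, max_eq_right]
        · rw [le_div_iff₀ h2]; linarith
        · rw [div_le_one h2]; linarith
      refine ⟨hb, ?_⟩
      rw [haz, hb]
      field_simp
      ring
    · right
      have hz2 : (1 / 2 : ℝ) ≤ |z| := by linarith [x.2.2.2]
      have hz0 : |z| ≠ 0 := by linarith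
      have hb : b x = (2 * |z| - 2 + x.2) / |z| := by
        show max 0 (2 * |z| - 2 + x.2) / max |z| (1 / 2) = _
        rw [max_eq_right hgt.le, max_eq_left hz2]
      have hb' : (2 - x.2) / (2 - b x) = |z| := by
        have : 2 - b x = (2 - x.2) / |z| := by
          rw [hb]; field_simp; ring
        rw [this]
        field_simp
      rw [hb']
      rcases abs_cases z with ⟨hzz, -⟩ | ⟨hzz, -⟩
      · have : a x = 1 := by
          show max (-1) (min 1 (2 * z / (2 - x.2))) = _
          rw [min_eq_left, max_eq_right (by norm_num)]
          rw [one_le_div h2]; linarith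
        rw [this]
        exact ⟨Or.inl rfl, by linarith⟩
      · have : a x = -1 := by
          show max (-1) (min 1 (2 * z / (2 - x.2))) = _
          rw [max_eq_left]
          refine (min_le_right _ _).trans ?_
          rw [div_le_iff₀ h2]; linarith
        rw [this]
        exact ⟨Or.inr rfl, by linarith⟩
  have recov : ∀ x : I × I, a x * (1 - l x) = 2 * x.1 - 1 := fun x => by
    rcases cases x with h | h <;> exact h.2
  -- Along each ray, the given retraction of `P × I` is applied.
  let ρ : (P × I) × I → P × I := fun z => r (z.1.1, P01 (l (z.1.2, z.2)))
  let R : (P × I) × I → (P × I) × I := fun z =>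
    (((ρ z).1, P01 ((a (z.1.2, z.2) * (1 - (ρ z).2) + 1) / 2)),
      P01 (b (z.1.2, z.2) + (ρ z).2 * (2 - b (z.1.2, z.2))))
  have hρ : Continuous ρ := by fun_prop
  have hR : Continuous R := by fun_prop
  have fix : ∀ z : (P × I) × I, ρ z = (z.1.1, P01 (l (z.1.2, z.2))) → R z = z := by
    rintro ⟨⟨p, t⟩, s⟩ h
    have hl' : ((P01 (l (t, s)) : I) : ℝ) = l (t, s) :=
      congrArg Subtype.val (Set.projIcc_of_mem zero_le_one ⟨hl0 (t, s), hl1 (t, s)⟩)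
    simp only [R, h, hl', recov, key]
    have : (2 * (t : ℝ) - 1 + 1) / 2 = t := by ring
    rw [this, hPv, hPv]
  have bdry0 : ∀ x : I × I, (x.2 = 0 ∨ x.1 = 0 ∨ x.1 = 1) → l x = 0 := by
    rintro ⟨t, s⟩ h
    have : b (t, s) = s := by
      refine le_antisymm (hbs _) ?_
      rcases h with h | h | h <;> simp only at h <;> subst h
      · exact hb0 _
      · simp only [b]; norm_num
      · simp only [b]; norm_num
    simp [l, this]
  have h00 : P01 0 = 0 := hPv 0
  refine ⟨?_, ⟨R, hR⟩, ?_, ?_, ?_⟩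
  · exact (isClosed_eq continuous_snd continuous_const).union
      ((isClosed_eq continuous_snd continuous_const).union (hc.preimage continuous_fst))
  · rintro ⟨p, t⟩
    apply fix
    simp [ρ, bdry0 (t, 0) (Or.inl rfl), h00, h0]
  · rintro ⟨p, t⟩ hp s
    apply fix
    rcases hp with hp | hp | hp
    · simp only [ρ, bdry0 (t, s) (Or.inr (Or.inl hp)), h00, h0]
    · simp only [ρ, bdry0 (t, s) (Or.inr (Or.inr hp)), h00, h0]
    · exact h1 p hp _
  · rintro ⟨⟨p, t⟩, s⟩
    rcases h2 (p, P01 (l (t, s))) with h | h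
    · have h' : (ρ ((p, t), s)).2 = 0 := h
      simp only [ContinuousMap.coe_mk, R, h']
      rcases cases (t, s) with ⟨hb, -⟩ | ⟨ha | ha, -⟩
      · left; simp [hb, h00]
      · right; right; left
        simpa [ha] using hPv 1
      · right; left
        simpa [ha] using h00
    · exact Or.inr (Or.inr (Or.inr h))

/-- The boundary of a cube is a cofibration. -/
theorem isCofib_cubeBoundary (n : ℕ) : IsCofib (Cube.boundary (Fin n)) := by
  induction n with
  | zero =>
    have : Cube.boundary (Fin 0) = ∅ := by
      ext y
      simp [Cube.boundary]
    rw [this]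
    exact IsCofib.empty
  | succ n ih =>
    let e : (Fin (n + 1) → I) ≃ₜ (Fin n → I) × I :=
      { toFun := fun y => (Fin.tail y, y 0)
        invFun := fun z => Fin.cons z.2 z.1
        left_inv := fun y => by simp
        right_inv := fun z => by simp
        continuous_toFun := by unfold Fin.tail; fun_prop
        continuous_invFun := by fun_prop }
    have := ih.cylBdry.preimage_homeomorph e
    convert! this using 1
    ext y
    simp only [Cube.boundary, _root_.cylBdry, Set.mem_ofPred_eq, Set.mem_preimage, e,
      Homeomorph.homeomorph_mk_coe, Equiv.coe_fn_mk, Fin.exists_fin_succ, Fin.tail, or_assoc]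

end Cofibration

/-! ### Deforming homotopies relative to a cofibration -/

section Glue

variable {P Z Y : Type*} [TopologicalSpace P] [TopologicalSpace Z] [TopologicalSpace Y] {A : Set P}

/-- Maps on `P × {0}`, `P × {1}` and `A × I` which agree on the intersections define a continuous map
on `cylBdry A`. -/
theorem exists_glue_cylBdry (hA : IsClosed A) (u v : C(P, Z)) (w : C(A × I, Z))
    (h0 : ∀ a, w (a, 0) = u a) (h1 : ∀ a, w (a, 1) = v a) :
    ∃ g : P × I → Z, ContinuousOn g (cylBdry A) ∧ (∀ p, g (p, 0) = u p) ∧ (∀ p, g (p, 1) = v p) ∧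
      ∀ (a : A) t, g (a, t) = w (a, t) := by
  classical
  let g : P × I → Z := fun z => if z.2 = 0 then u z.1 else if z.2 = 1 then v z.1 else
    if hz : z.1 ∈ A then w (⟨z.1, hz⟩, z.2) else u z.1
  have g0 : ∀ z : P × I, z.2 = 0 → g z = u z.1 := fun z hz => by simp [g, hz]
  have g1 : ∀ z : P × I, z.2 = 1 → g z = v z.1 := fun z hz => by simp [g, hz]
  have gA : ∀ (z : P × I) (h : z.1 ∈ A), g z = w (⟨z.1, h⟩, z.2) := by
    rintro ⟨p, t⟩ h
    by_cases ht : t = 0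
    · subst ht
      exact (g0 _ rfl).trans (h0 ⟨p, h⟩).symm
    · by_cases ht1 : t = 1
      · subst ht1
        exact (g1 _ rfl).trans (h1 ⟨p, h⟩).symm
      · simp only at h
        simp [g, ht, ht1, h]
  have c0 : ContinuousOn g {z : P × I | z.2 = 0} :=
    (u.continuous.comp continuous_fst).continuousOn.congr fun z hz => g0 z hz
  have c1 : ContinuousOn g {z : P × I | z.2 = 1} :=
    (v.continuous.comp continuous_fst).continuousOn.congr fun z hz => g1 z hz
  have cA : ContinuousOn g {z : P × I | z.1 ∈ A} := by
    rw [continuousOn_iff_continuous_domRestrict]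
    have : Set.domRestrict {z : P × I | z.1 ∈ A} g =
        fun z => w (⟨z.1.1, z.2⟩, z.1.2) := by
      ext z
      exact gA z.1 z.2
    rw [this]
    fun_prop
  have e0 : IsClosed {z : P × I | z.2 = 0} := isClosed_eq continuous_snd continuous_const
  have e1 : IsClosed {z : P × I | z.2 = 1} := isClosed_eq continuous_snd continuous_const
  have eA : IsClosed {z : P × I | z.1 ∈ A} := hA.preimage continuous_fst
  have cg : ContinuousOn g (cylBdry A) :=
    ContinuousOn.union_of_isClosed c0 (ContinuousOn.union_of_isClosed c1 cA e1 eA) e0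
      (e1.union eA)
  exact ⟨g, cg, fun p => g0 (p, 0) rfl, fun p => g1 (p, 1) rfl, fun a t => gA (a, t) a.2⟩

theorem Path.map_trans_apply {M N : Type*} [TopologicalSpace M] [TopologicalSpace N] (φ : M → N)
    {x y z : M} {x' y' z' : N} (γ₁ : Path x y) (γ₂ : Path y z) (δ₁ : Path x' y') (δ₂ : Path y' z')
    (h₁ : ∀ t, δ₁ t = φ (γ₁ t)) (h₂ : ∀ t, δ₂ t = φ (γ₂ t)) (t : I) :
    (δ₁.trans δ₂) t = φ ((γ₁.trans γ₂) t) := by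
  simp only [Path.trans_apply]
  split_ifs
  · exact h₁ _
  · exact h₂ _

/-- A homotopy whose restriction to a cofibration `A` is a null-homotopic loop can be replaced by
a homotopy relative to `A`. -/
theorem IsCofib.homotopicRel_of_nullhomotopic [CompactSpace P] [T2Space P] (hA : IsCofib A)
    {u v : C(P, Y)} (c : Path u v) {x : C(A, Y)} (γ : Path x x)
    (hγ : γ.Homotopic (Path.refl x)) (h : ∀ t, γ t = (c t).restrict A) :
    u.HomotopicRel v A := by
  have : CompactSpace A := isCompact_iff_compactSpace.1 hA.isClosed.isCompact
  obtain ⟨G⟩ := hγ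
  let G' : C((A × I) × I, Y) := ⟨fun z => G (z.2, z.1.2) z.1.1, by fun_prop⟩
  have hu : ∀ a : A, x a = u a := fun a => by
    simpa using DFunLike.congr_fun (h 0) a
  have hv : ∀ a : A, x a = v a := fun a => by
    simpa using DFunLike.congr_fun (h 1) a
  obtain ⟨g, cg, g0, g1, gA⟩ := exists_glue_cylBdry (Z := C(I, Y)) hA.isClosed
    ((ContinuousMap.const' (X := I)).comp u) ((ContinuousMap.const' (X := I)).comp v) G'.curry
    (fun a => by ext s; simp [G', hu]) (fun a => by ext s; simp [G', hv])
  let c' : C(P × I, Y) := ⟨fun z => c z.2 z.1, by fun_prop⟩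
  let g' : C(_root_.cylBdry A, C(I, Y)) := ⟨_, continuousOn_iff_continuous_domRestrict.1 cg⟩
  obtain ⟨F, F0, F1⟩ := hA.cylBdry.extend c' g'.uncurry (by
    rintro ⟨⟨p, t⟩, hz⟩
    change g (p, t) 0 = c t p
    rcases hz with (rfl : t = 0) | (rfl : t = 1) | (hp : p ∈ A)
    · simp [g0]
    · simp [g1]
    · have := DFunLike.congr_fun (h t) ⟨p, hp⟩
      rw [gA ⟨p, hp⟩ t]
      simpa [G'] using this)
  have F1' : ∀ (p : P) (t : I), (p, t) ∈ _root_.cylBdry A → F ((p, t), 1) = g (p, t) 1 :=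
    fun p t hz => F1 ⟨(p, t), hz⟩ 1
  refine ⟨⟨⟨⟨fun z => F ((z.2, z.1), 1), by fun_prop⟩, fun p => ?_, fun p => ?_⟩, fun t p hp => ?_⟩⟩
  · simp [F1' p 0 (Or.inl rfl), g0]
  · simp [F1' p 1 (Or.inr (Or.inl rfl)), g1]
  · change F ((p, t), 1) = u p
    rw [F1' p t (Or.inr (Or.inr hp)), gA ⟨p, hp⟩]
    simp [G', hu]

end Glue

/-! ### The homotopy extension and lifting property -/

section HELP

variable {X Y Z : Type*} [TopologicalSpace X] [TopologicalSpace Y] [TopologicalSpace Z]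

/-- The homotopy extension and lifting property: a map `P → Y` whose restriction to a cofibration
`A ⊆ P` is lifted to `X` can be lifted to `X` up to a homotopy relative to `A`, for all compact
Hausdorff spaces `P`. -/
def HasHELP (f : C(X, Y)) : Prop :=
  ∀ (P : Type) [TopologicalSpace P] [CompactSpace P] [T2Space P] (A : Set P), IsCofib A →
    ∀ (α : C(A, X)) (b : C(P, Y)), (∀ p : A, b p = f (α p)) →
      ∃ a : C(P, X), (∀ p : A, a p = α p) ∧ (f.comp a).HomotopicRel b A

/-- Postcomposition with `f` on spaces of maps out of `P`. -/
def postcompMap (P : Type*) [TopologicalSpace P] (f : C(X, Y)) : C(C(P, X), C(P, Y)) :=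
  ⟨f.comp, ContinuousMap.continuous_postcomp f⟩

/-- The functor which `F` induces on fundamental groupoids is full and essentially surjective. -/
structure IsPathFull {M N : Type*} [TopologicalSpace M] [TopologicalSpace N] (F : C(M, N)) :
    Prop where
  full : (FundamentalGroupoid.map F).Full
  essSurj : (FundamentalGroupoid.map F).EssSurj

/-- For all compact Hausdorff spaces `P`, the functor which `f` induces on the fundamental
groupoids of the spaces of maps out of `P` is full and essentially surjective. -/
def IsMappingPathFull (f : C(X, Y)) : Prop :=
  ∀ (P : Type) [TopologicalSpace P] [CompactSpace P] [T2Space P], IsPathFull (postcompMap P f)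

section PathFull

open CategoryTheory

variable {M N K : Type*} [TopologicalSpace M] [TopologicalSpace N] [TopologicalSpace K]

theorem isPathFull_iff (F : C(M, N)) : IsPathFull F ↔ (∀ n, ∃ m, Joined (F m) n) ∧
    ∀ (m₀ m₁ : M) (κ : Path (F m₀) (F m₁)), ∃ q : Path m₀ m₁,
      (q.map F.continuous).Homotopic κ := by
  constructor
  · rintro ⟨h1, h2⟩
    refine ⟨fun n => ?_, fun m₀ m₁ κ => ?_⟩
    · obtain ⟨⟨m⟩, ⟨i⟩⟩ := h2.mem_essImage ⟨n⟩
      obtain ⟨p, -⟩ := Path.Homotopic.Quotient.mk_surjective i.hom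
      exact ⟨m, ⟨p⟩⟩
    · obtain ⟨q, hq⟩ := h1.map_surjective (X := ⟨m₀⟩) (Y := ⟨m₁⟩)
        (Path.Homotopic.Quotient.mk κ)
      obtain ⟨q, rfl⟩ := Path.Homotopic.Quotient.mk_surjective q
      exact ⟨q, Path.Homotopic.Quotient.exact hq⟩
  · rintro ⟨h1, h2⟩
    refine ⟨⟨?_⟩, ⟨?_⟩⟩
    · rintro ⟨m₀⟩ ⟨m₁⟩ κ
      obtain ⟨κ, rfl⟩ := Path.Homotopic.Quotient.mk_surjective κ
      obtain ⟨q, hq⟩ := h2 m₀ m₁ κ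
      exact ⟨Path.Homotopic.Quotient.mk q, Path.Homotopic.Quotient.eq.2 hq⟩
    · rintro ⟨n⟩
      obtain ⟨m, ⟨p⟩⟩ := h1 n
      have i : (FundamentalGroupoid.map F).obj ⟨m⟩ ⟶ ⟨n⟩ := Path.Homotopic.Quotient.mk p
      exact ⟨⟨m⟩, ⟨asIso i⟩⟩

theorem IsPathFull.comp {G : C(N, K)} {F : C(M, N)} (hG : IsPathFull G) (hF : IsPathFull F) :
    IsPathFull (G.comp F) := by
  have := hG.full
  have := hG.essSurj
  have := hF.full
  have := hF.essSurj
  constructor <;> rw [FundamentalGroupoid.map_comp] <;> infer_instance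

theorem IsPathFull.of_comp {G : C(N, K)} {F : C(M, N)} (h : IsPathFull (G.comp F))
    (hF : IsPathFull F) : IsPathFull G := by
  have h1 := h.full
  have h2 := h.essSurj
  have := hF.full
  have := hF.essSurj
  rw [FundamentalGroupoid.map_comp] at h1 h2
  set F' := FundamentalGroupoid.map F
  set G' := FundamentalGroupoid.map G
  refine ⟨⟨fun {x y} κ => ?_⟩, ⟨fun z => ?_⟩⟩
  · obtain ⟨q, hq⟩ := (F' ⋙ G').map_surjective
      (G'.map (F'.objObjPreimageIso x).hom ≫ κ ≫ G'.map (F'.objObjPreimageIso y).inv)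
    refine ⟨(F'.objObjPreimageIso x).inv ≫ F'.map q ≫ (F'.objObjPreimageIso y).hom, ?_⟩
    rw [Functor.comp_map] at hq
    change G'.map _ = κ
    rw [Functor.map_comp, Functor.map_comp, hq, Category.assoc, Category.assoc,
      ← Functor.map_comp, Iso.inv_hom_id, ← Functor.map_comp_assoc, Iso.inv_hom_id]
    rw [CategoryTheory.Functor.map_id, CategoryTheory.Functor.map_id, Category.comp_id, Category.id_comp]
  · exact ⟨F'.obj ((F' ⋙ G').objPreimage z), ⟨(F' ⋙ G').objObjPreimageIso z⟩⟩

theorem IsPathFull.of_homotopic {F F' : C(M, N)} (hF : IsPathFull F) (h : F.Homotopic F') :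
    IsPathFull F' := by
  obtain ⟨H⟩ := h
  have := hF.full
  have := hF.essSurj
  exact ⟨Functor.Full.of_iso (asIso (FundamentalGroupoidFunctor.homotopicMapsNatIso H)),
    Functor.essSurj_of_iso (asIso (FundamentalGroupoidFunctor.homotopicMapsNatIso H))⟩

theorem IsPathFull.of_homotopyEquiv {F : C(M, N)} (h : IsHomotopyEquiv F) : IsPathFull F := by
  obtain ⟨e, rfl⟩ := h
  have : (FundamentalGroupoid.map e.toFun).IsEquivalence :=
    (FundamentalGroupoidFunctor.equivOfHomotopyEquiv e).isEquivalence_functor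
  exact ⟨inferInstance, inferInstance⟩

end PathFull

theorem ContinuousMap.Homotopic.postcompMap {P : Type*} [TopologicalSpace P] [LocallyCompactSpace P]
    {f g : C(X, Y)} (h : f.Homotopic g) :
    (_root_.postcompMap P f).Homotopic (_root_.postcompMap P g) := by
  obtain ⟨H⟩ := h
  let F : C((I × C(P, X)) × P, Y) := ⟨fun z => H (z.1.1, z.1.2 z.2), by fun_prop⟩
  refine ⟨⟨F.curry, fun u => ?_, fun u => ?_⟩⟩ <;> ext p <;>
    simp [F, _root_.postcompMap]

theorem IsMappingPathFull.of_isHomotopyEquiv {f : C(X, Y)} (h : IsHomotopyEquiv f) :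
    IsMappingPathFull f := by
  intro P _ _ _
  obtain ⟨e, rfl⟩ := h
  exact IsPathFull.of_homotopyEquiv ⟨⟨postcompMap P e.toFun, postcompMap P e.invFun,
    e.left_inv.postcompMap, e.right_inv.postcompMap⟩, rfl⟩

theorem IsMappingPathFull.comp {g : C(Y, Z)} {f : C(X, Y)} (hg : IsMappingPathFull g)
    (hf : IsMappingPathFull f) : IsMappingPathFull (g.comp f) :=
  fun P _ _ _ => (hg P).comp (hf P)

theorem IsMappingPathFull.of_comp {g : C(Y, Z)} {f : C(X, Y)} (h : IsMappingPathFull (g.comp f))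
    (hf : IsMappingPathFull f) : IsMappingPathFull g :=
  fun P _ _ _ => IsPathFull.of_comp (F := postcompMap P f) (h P) (hf P)

theorem IsMappingPathFull.of_homotopic {f g : C(X, Y)} (hf : IsMappingPathFull f)
    (h : f.Homotopic g) : IsMappingPathFull g :=
  fun P _ _ _ => (hf P).of_homotopic h.postcompMap

/-- Essential surjectivity gives a lift `a₀` of `b` up to a homotopy, and fullness a path in `C(A, X)`
from the restriction of `a₀` to `α` which maps to that homotopy on `A`. The homotopy extension
property turns `a₀` into an extension of `α`. -/
theorem IsMappingPathFull.hasHELP {f : C(X, Y)} (hf : IsMappingPathFull f) : HasHELP f := by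
  intro P _ _ _ A hA α b hb
  have : CompactSpace A := isCompact_iff_compactSpace.1 hA.isClosed.isCompact
  obtain ⟨a₀, ⟨p⟩⟩ := ((isPathFull_iff _).1 (hf P)).1 b
  let rA : C(C(P, Y), C(A, Y)) := ⟨_, ContinuousMap.continuous_restrict A⟩
  let κ : Path (postcompMap A f (a₀.restrict A)) (postcompMap A f α) :=
    (p.map rA.continuous).cast rfl (by ext x; exact (hb x).symm)
  obtain ⟨q, hq⟩ := ((isPathFull_iff _).1 (hf A)).2 _ _ κ
  obtain ⟨F, F0, F1⟩ := hA.extend a₀ ⟨fun z => q z.2 z.1, by fun_prop⟩ (fun a => by simp)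
  let F' : C(I × P, X) := ⟨fun z => F (z.2, z.1), by fun_prop⟩
  let Q : Path a₀ (F'.curry 1) :=
    { toContinuousMap := F'.curry
      source' := by ext p; simp [F', F0]
      target' := rfl }
  refine ⟨F'.curry 1, fun x => ?_, ?_⟩
  · simp [F', F1]
  · refine hA.homotopicRel_of_nullhomotopic
      ((Q.map (postcompMap P f).continuous).symm.trans p)
      ((q.map (postcompMap A f).continuous).symm.trans κ) ?_ fun t => ?_
    · rw [← Path.Homotopic.Quotient.eq] at hq ⊢
      rw [Path.Homotopic.Quotient.mk_trans, Path.Homotopic.Quotient.mk_symm, hq,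
        Path.Homotopic.Quotient.symm_trans, Path.Homotopic.Quotient.mk_refl]
    · refine Path.map_trans_apply (ContinuousMap.restrict A) _ _ _ _ (fun t => ?_) (fun t => ?_) t
      · ext x
        exact congrArg f (F1 x (σ t)).symm
      · rfl

end HELP

/-! ### Lifting homotopies, and mapping spaces relative to a subspace -/

section Lifting

variable {X Y : Type*} [TopologicalSpace X] [TopologicalSpace Y]
  {P : Type} [TopologicalSpace P] [CompactSpace P] [T2Space P] {A : Set P}

/-- Under the homotopy extension and lifting property, homotopies relative to a cofibration lift up
to a homotopy of homotopies. -/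
theorem HasHELP.exists_lift_homotopy {f : C(X, Y)} (hf : HasHELP f) (hA : IsCofib A)
    (x₀ x₁ : C(P, X)) (hx : ∀ p ∈ A, x₀ p = x₁ p) (k : C(P × I, Y)) (k0 : ∀ p, k (p, 0) = f (x₀ p))
    (k1 : ∀ p, k (p, 1) = f (x₁ p)) (kA : ∀ p ∈ A, ∀ t, k (p, t) = f (x₀ p)) :
    ∃ q : C(P × I, X), (∀ p, q (p, 0) = x₀ p) ∧ (∀ p, q (p, 1) = x₁ p) ∧
      (∀ p ∈ A, ∀ t, q (p, t) = x₀ p) ∧ (f.comp q).HomotopicRel k (cylBdry A) := by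
  obtain ⟨g, cg, g0, g1, gA⟩ := exists_glue_cylBdry hA.isClosed x₀ x₁
    ⟨fun z => x₀ z.1, by fun_prop⟩ (fun a => rfl) (fun a => hx a a.2)
  obtain ⟨q, hq, H⟩ := hf (P × I) (cylBdry A) hA.cylBdry
    ⟨_, continuousOn_iff_continuous_domRestrict.1 cg⟩ k (by
      rintro ⟨⟨p, t⟩, hz⟩
      change k (p, t) = f (g (p, t))
      rcases hz with (rfl : t = 0) | (rfl : t = 1) | (hp : p ∈ A)
      · rw [k0, g0]
      · rw [k1, g1]
      · rw [kA p hp, gA ⟨p, hp⟩]; rfl)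
  have hq' : ∀ z ∈ cylBdry A, q z = g z := fun z hz => hq ⟨z, hz⟩
  refine ⟨q, fun p => ?_, fun p => ?_, fun p hp t => ?_, H⟩
  · rw [hq' _ (Or.inl rfl), g0]
  · rw [hq' _ (Or.inr (Or.inl rfl)), g1]
  · rw [hq' _ (Or.inr (Or.inr hp)), gA ⟨p, hp⟩]; rfl

end Lifting

section RelMaps

variable {P Y Z : Type*} [TopologicalSpace P] [TopologicalSpace Y] [TopologicalSpace Z]
  {A : Set P} {β : P → Y}

/-- The space of maps `P → Y` which agree with `β` on `A`. -/
def RelMaps (A : Set P) (β : P → Y) : Set C(P, Y) := {w | Set.EqOn w β A}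

/-- A homotopy relative to `A`, as a path in a space of maps. -/
def RelMaps.path {u v : RelMaps A β} (F : C(P × I, Y)) (h0 : ∀ p, F (p, 0) = u.1 p)
    (h1 : ∀ p, F (p, 1) = v.1 p) (hA : ∀ p ∈ A, ∀ t, F (p, t) = β p) : Path u v where
  toFun t := ⟨⟨fun p => F (p, t), by fun_prop⟩, fun p hp => hA p hp t⟩
  continuous_toFun := Continuous.subtype_mk
    (ContinuousMap.curry ⟨fun z : I × P => F (z.2, z.1), by fun_prop⟩).continuous _
  source' := Subtype.ext (ContinuousMap.ext h0)
  target' := Subtype.ext (ContinuousMap.ext h1)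

/-- A path in a space of maps, as a homotopy. -/
def RelMaps.cylinder [LocallyCompactSpace P] {u v : RelMaps A β} (γ : Path u v) : C(P × I, Y) :=
  ⟨fun z => (γ z.2).1 z.1, by
    have : Continuous fun z : P × I => (γ z.2).1 :=
      continuous_subtype_val.comp (γ.continuous.comp continuous_snd)
    fun_prop⟩

/-- Postcomposition with `f` on spaces of maps with prescribed values on `A`. -/
def RelMaps.postcomp (A : Set P) (β : P → Y) (f : C(Y, Z)) :
    C(RelMaps A β, RelMaps A (f ∘ β)) where
  toFun w := ⟨f.comp w.1, fun _ hp => congrArg f (w.2 hp)⟩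
  continuous_toFun := Continuous.subtype_mk
    ((ContinuousMap.continuous_postcomp f).comp continuous_subtype_val) _

theorem RelMaps.homotopic_of_homotopicRel [LocallyCompactSpace P] {u v : RelMaps A β}
    {γ δ : Path u v} (h : (cylinder γ).HomotopicRel (cylinder δ) (cylBdry A)) :
    γ.Homotopic δ := by
  obtain ⟨H⟩ := h
  let F : C((I × I) × P, Y) := ⟨fun z => H (z.1.1, (z.2, z.1.2)), by fun_prop⟩
  have hF : ∀ (s t : I) (p : P), (p, t) ∈ cylBdry A → F ((s, t), p) = (γ t).1 p :=
    fun s t p hz => H.eq_fst s hz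
  refine ⟨⟨⟨⟨fun z => ⟨F.curry z, fun p hp => ?_⟩, ?_⟩, fun t => ?_, fun t => ?_⟩, ?_⟩⟩
  · exact (hF z.1 z.2 p (Or.inr (Or.inr hp))).trans ((γ z.2).2 hp)
  · exact Continuous.subtype_mk F.curry.continuous _
  · exact Subtype.ext (ContinuousMap.ext fun p => H.apply_zero (p, t))
  · exact Subtype.ext (ContinuousMap.ext fun p => H.apply_one (p, t))
  · rintro s t (rfl | ht)
    · exact Subtype.ext (ContinuousMap.ext fun p => hF s 0 p (Or.inl rfl))
    · obtain rfl : t = 1 := ht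
      exact Subtype.ext (ContinuousMap.ext fun p => hF s 1 p (Or.inr (Or.inl rfl)))

theorem RelMaps.homotopicRel_of_homotopic [LocallyCompactSpace P] {u v : RelMaps A β}
    {γ δ : Path u v} (h : γ.Homotopic δ) :
    (cylinder γ).HomotopicRel (cylinder δ) (cylBdry A) := by
  obtain ⟨H⟩ := h
  have c : Continuous fun z : I × (P × I) => (H (z.1, z.2.2)).1 := by fun_prop
  refine ⟨⟨⟨⟨fun z => (H (z.1, z.2.2)).1 z.2.1, by fun_prop⟩, fun z => ?_, fun z => ?_⟩, ?_⟩⟩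
  · simp [cylinder]
  · simp [cylinder]
  · rintro s ⟨p, t⟩ (ht | ht | hp)
    · obtain rfl : t = 0 := ht
      simp [cylinder]
    · obtain rfl : t = 1 := ht
      simp [cylinder]
    · exact ((H (s, t)).2 hp).trans ((γ t).2 hp).symm

theorem Path.Homotopic.symm_trans_of_trans_symm {M : Type*} [TopologicalSpace M] {x y z : M}
    {h : Path x z} {k : Path x y} {c : Path z y} (H : h.Homotopic (k.trans c.symm)) :
    (h.symm.trans k).Homotopic c := by
  rw [← Path.Homotopic.Quotient.eq] at H ⊢
  simp only [Path.Homotopic.Quotient.mk_trans, Path.Homotopic.Quotient.mk_symm] at H ⊢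
  have hk : Path.Homotopic.Quotient.mk k =
      (Path.Homotopic.Quotient.mk h).trans (Path.Homotopic.Quotient.mk c) := by
    rw [H, Path.Homotopic.Quotient.trans_assoc, Path.Homotopic.Quotient.symm_trans,
      Path.Homotopic.Quotient.trans_refl]
  rw [hk, ← Path.Homotopic.Quotient.trans_assoc, Path.Homotopic.Quotient.symm_trans,
    Path.Homotopic.Quotient.refl_trans]

end RelMaps

/-! ### Consequences of the homotopy extension and lifting property -/

section Mapping

variable {X Y : Type*} [TopologicalSpace X] [TopologicalSpace Y] {f : C(X, Y)}

theorem HasHELP.isMappingPathFull (hf : HasHELP f) : IsMappingPathFull f := by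
  intro P _ _ _
  rw [isPathFull_iff]
  refine ⟨fun b => ?_, fun a₀ a₁ κ => ?_⟩
  · obtain ⟨a, -, H⟩ := hf P ∅ IsCofib.empty ⟨fun p => p.2.elim, by fun_prop⟩ b
      (fun p => p.2.elim)
    obtain ⟨H⟩ := H.homotopic
    exact ⟨a, ⟨⟨H.curry, H.curry_zero, H.curry_one⟩⟩⟩
  · have hm : ∀ (β : P → Y) (w : C(P, Y)), w ∈ RelMaps ∅ β := fun _ _ p hp => hp.elim
    have hm' : ∀ (β : P → X) (w : C(P, X)), w ∈ RelMaps ∅ β := fun _ _ p hp => hp.elim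
    let β : P → X := a₀
    let κ' : Path (⟨f.comp a₀, hm _ _⟩ : RelMaps ∅ (f ∘ β)) ⟨f.comp a₁, hm _ _⟩ :=
      { toFun := fun t => ⟨κ t, hm _ _⟩
        continuous_toFun := Continuous.subtype_mk κ.continuous _
        source' := Subtype.ext κ.source
        target' := Subtype.ext κ.target }
    obtain ⟨q, q0, q1, -, H⟩ := hf.exists_lift_homotopy IsCofib.empty a₀ a₁
      (fun p hp => hp.elim) (RelMaps.cylinder κ') (fun p => DFunLike.congr_fun κ.source p)
      (fun p => DFunLike.congr_fun κ.target p) (fun p hp => hp.elim)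
    let q' : Path (⟨a₀, hm' _ _⟩ : RelMaps ∅ β) ⟨a₁, hm' _ _⟩ :=
      RelMaps.path q q0 q1 (fun p hp => hp.elim)
    have h := RelMaps.homotopic_of_homotopicRel
      (γ := q'.map (RelMaps.postcomp ∅ β f).continuous) (δ := κ') H
    exact ⟨q'.map continuous_subtype_val, h.map ⟨_, continuous_subtype_val⟩⟩

/-- Surjectivity on homotopy groups is a lifting problem for the boundary of a cube, and injectivity
one for the boundary of the cylinder on a cube. -/
theorem HasHELP.isWeakHomotopyEquiv (hf : HasHELP f) : IsWeakHomotopyEquiv f := by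
  refine ⟨⟨?_, ?_⟩, fun n a => ⟨?_, ?_⟩⟩
  · rintro ⟨a₀⟩ ⟨a₁⟩ h
    obtain ⟨κ⟩ : Joined (f a₀) (f a₁) := Quotient.exact h
    obtain ⟨q, q0, q1, -, -⟩ := hf.exists_lift_homotopy (P := Unit) IsCofib.empty
      (.const _ a₀) (.const _ a₁) (fun p hp => hp.elim) ⟨fun z => κ z.2, by fun_prop⟩
      (fun p => by simp) (fun p => by simp) (fun p hp => hp.elim)
    exact Quotient.sound ⟨⟨⟨fun t => q ((), t), by fun_prop⟩, q0 (), q1 ()⟩⟩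
  · rintro ⟨b⟩
    obtain ⟨a, -, ⟨H⟩⟩ := hf Unit ∅ IsCofib.empty ⟨fun p => p.2.elim, by fun_prop⟩ (.const _ b)
      (fun p => p.2.elim)
    exact ⟨Quotient.mk _ (a ()), Quotient.sound ⟨H.toHomotopy.evalAt ()⟩⟩
  · rintro ⟨p⟩ ⟨q⟩ h
    obtain ⟨H⟩ : (f.comp p.1).HomotopicRel (f.comp q.1) (Cube.boundary (Fin n)) :=
      Quotient.exact h
    obtain ⟨K, K0, K1, KA, -⟩ := hf.exists_lift_homotopy (isCofib_cubeBoundary n) p.1 q.1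
      (fun y hy => (p.2 y hy).trans (q.2 y hy).symm) ⟨fun z => H (z.2, z.1), by fun_prop⟩
      (fun y => H.apply_zero y) (fun y => H.apply_one y) (fun y hy t => H.eq_fst t hy)
    exact Quotient.sound ⟨⟨⟨⟨fun z => K (z.2, z.1), by fun_prop⟩, K0, K1⟩, fun t y hy => KA y hy t⟩⟩
  · rintro ⟨q⟩
    obtain ⟨p, hp, H⟩ := hf _ _ (isCofib_cubeBoundary n) (.const _ a) q.1 fun y => q.2 y y.2
    exact ⟨Quotient.mk _ ⟨p, fun y hy => hp ⟨y, hy⟩⟩, Quotient.sound H⟩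

end Mapping

/-! ### Lifting over a base -/

section Fibration

variable {L S : Type*} [TopologicalSpace L] [TopologicalSpace S]

/-- A map with the homotopy lifting property for compact Hausdorff spaces, where the lifts can be
chosen to be stationary wherever the homotopy is. -/
def IsRegularFibration (e : C(L, S)) : Prop :=
  ∀ (P : Type) [TopologicalSpace P] [CompactSpace P] [T2Space P] (x : C(P, L)) (h : C(P × I, S)),
    (∀ p, h (p, 0) = e (x p)) → ∃ H : C(P × I, L), (∀ p, H (p, 0) = x p) ∧ (∀ z, e (H z) = h z) ∧
      ∀ p, (∀ t, h (p, t) = e (x p)) → ∀ t, H (p, t) = x p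

variable {LX LY SX SY : Type*} [TopologicalSpace LX] [TopologicalSpace LY] [TopologicalSpace SX]
  [TopologicalSpace SY] {eX : C(LX, SX)} {eY : C(LY, SY)} {fL : C(LX, LY)} {fS : C(SX, SY)}

/-- In a commutative square of maps with the homotopy extension and lifting property between regular
fibrations, a solution `a₀, c₀` of the lifting problem in the base is covered by a solution `a, c` in
the total spaces. A solution in the total spaces is moved over the given one, along a homotopy which
exists by the lifting property in the base. -/
theorem HasHELP.exists_lift_over (hsq : ∀ x, eY (fL x) = fS (eX x)) (hX : IsRegularFibration eX)
    (hY : IsRegularFibration eY) (hL : HasHELP fL) (hS : HasHELP fS)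
    {P : Type} [TopologicalSpace P] [CompactSpace P] [T2Space P] {A : Set P} (hA : IsCofib A)
    (α : C(A, LX)) (b : C(P, LY)) (hb : ∀ p : A, b p = fL (α p))
    (a₀ : C(P, SX)) (ha₀ : ∀ p : A, a₀ p = eX (α p))
    (c₀ : C(P × I, SY)) (c00 : ∀ p, c₀ (p, 0) = fS (a₀ p)) (c01 : ∀ p, c₀ (p, 1) = eY (b p))
    (c0A : ∀ p ∈ A, ∀ t, c₀ (p, t) = eY (b p)) :
    ∃ a : C(P, LX), (∀ p : A, a p = α p) ∧ (∀ p, eX (a p) = a₀ p) ∧ ∃ c : C(P × I, LY),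
      (∀ p, c (p, 0) = fL (a p)) ∧ (∀ p, c (p, 1) = b p) ∧ (∀ p ∈ A, ∀ t, c (p, t) = b p) ∧
      ∀ z, eY (c z) = c₀ z := by
  -- A lift of `b` which need not lie over `a₀`.
  obtain ⟨a', ha', ⟨k⟩⟩ := hL P A hA α b hb
  have hbA : ∀ p ∈ A, b p = fL (a' p) := fun p hp => by rw [hb ⟨p, hp⟩, ← ha' ⟨p, hp⟩]
  have ha₀A : ∀ p ∈ A, a₀ p = eX (a' p) := fun p hp => by rw [ha₀ ⟨p, hp⟩, ← ha' ⟨p, hp⟩]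
  -- The spaces of maps with the prescribed values on `A`, and the paths in them.
  let βY : P → LY := fL ∘ a'
  let βT : P → SY := eY ∘ βY
  let pk : Path (⟨fL.comp a', fun _ _ => rfl⟩ : RelMaps A βY) ⟨b, fun p hp => hbA p hp⟩ :=
    RelMaps.path ⟨fun z => k (z.2, z.1), by fun_prop⟩ (fun p => k.apply_zero p)
      (fun p => k.apply_one p) (fun p hp t => k.eq_fst t hp)
  let pc₀ : Path (⟨fS.comp a₀, fun p hp => by
        simp [βT, βY, ha₀A p hp, hsq]⟩ : RelMaps A βT)
      ⟨eY.comp b, fun p hp => by simp [βT, βY, hbA p hp]⟩ :=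
    RelMaps.path c₀ c00 c01 (fun p hp t => by simp [c0A p hp, hbA p hp, βT, βY])
  let pek := pk.map (RelMaps.postcomp A βY eY).continuous
  let d := pek.trans pc₀.symm
  have hd0 : ∀ p, RelMaps.cylinder d (p, 0) = fS (eX (a' p)) := fun p => by
    change (d 0).1 p = _
    rw [d.source]
    exact hsq _
  have hd1 : ∀ p, RelMaps.cylinder d (p, 1) = fS (a₀ p) := fun p => by
    change (d 1).1 p = _
    rw [d.target]
    rfl
  obtain ⟨h, h0, h1, hA', hd⟩ := hS.exists_lift_homotopy hA (eX.comp a') a₀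
    (fun p hp => (ha₀A p hp).symm) (RelMaps.cylinder d) hd0 hd1
    (fun p hp t => ((d t).2 hp).trans (hsq _))
  let ph : Path (RelMaps.postcomp A βY eY ⟨fL.comp a', fun _ _ => rfl⟩)
      (⟨fS.comp a₀, fun p hp => by simp [βT, βY, ha₀A p hp, hsq]⟩ : RelMaps A βT) :=
    RelMaps.path (fS.comp h) (fun p => by simp [h0, hsq, RelMaps.postcomp]) (fun p => by simp [h1])
      (fun p hp t => by simp [hA' p hp, βY, hsq])
  have hph : (ph.symm.trans pek).Homotopic pc₀ :=
    Path.Homotopic.symm_trans_of_trans_symm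
      (RelMaps.homotopic_of_homotopicRel (γ := ph) (δ := d) hd)
  -- The lift of `h` to `LX` ends at the required map `a`.
  obtain ⟨H, H0, H1, HA⟩ := hX P a' h h0
  let a : C(P, LX) := ⟨fun p => H (p, 1), by fun_prop⟩
  have haA : ∀ p ∈ A, ∀ t, H (p, t) = a' p := fun p hp t => HA p (fun t => hA' p hp t) t
  let pH : Path (⟨fL.comp a', fun _ _ => rfl⟩ : RelMaps A βY)
      ⟨fL.comp a, fun p hp => by simp [a, βY, haA p hp]⟩ :=
    RelMaps.path (fL.comp H) (fun p => by simp [H0]) (fun p => rfl)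
      (fun p hp t => by simp [haA p hp, βY])
  let c₁ := pH.symm.trans pk
  have hc : ∀ t, (ph.symm.trans pek) t = RelMaps.postcomp A βY eY (c₁ t) :=
    Path.map_trans_apply (RelMaps.postcomp A βY eY) _ _ _ _
      (fun t => Subtype.ext (ContinuousMap.ext fun p =>
        ((hsq _).trans (congrArg fS (H1 (p, σ t)))).symm)) (fun t => rfl)
  obtain ⟨K⟩ := RelMaps.homotopicRel_of_homotopic hph
  -- Correct the homotopy `c₁` so that it lies over `c₀`.
  obtain ⟨C, C0, C1, CB⟩ := hY (P × I) (RelMaps.cylinder c₁)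
    ⟨fun z => K (z.2, z.1), by fun_prop⟩ (fun z => by
      change K (0, z) = _
      rw [K.apply_zero]
      exact congrArg (fun w => w.1 z.1) (hc z.2))
  have CB' : ∀ z ∈ cylBdry A, C (z, 1) = (c₁ z.2).1 z.1 := fun z hz => by
    refine CB z (fun t => ?_) 1
    change K (t, z) = _
    rw [K.eq_fst t hz]
    exact congrArg (fun w => w.1 z.1) (hc z.2)
  refine ⟨a, fun p => (haA p p.2 1).trans (ha' p), fun p => ?_, ⟨fun z => C (z, 1), by fun_prop⟩,
    fun p => ?_, fun p => ?_, fun p hp t => ?_, fun z => ?_⟩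
  · exact (H1 (p, 1)).trans (h1 p)
  · refine (CB' (p, 0) (Or.inl rfl)).trans ?_
    change (c₁ 0).1 p = _
    rw [c₁.source]
    rfl
  · refine (CB' (p, 1) (Or.inr (Or.inl rfl))).trans ?_
    change (c₁ 1).1 p = _
    rw [c₁.target]
  · exact (CB' (p, t) (Or.inr (Or.inr hp))).trans (((c₁ t).2 hp).trans (hbA p hp).symm)
  · exact (C1 (z, 1)).trans (K.apply_one z)

end Fibration

/-! ### Exit paths and mapping cylinder neighborhoods -/

section ExitPaths

variable {Z W : Type*} [TopologicalSpace Z] [TopologicalSpace W]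

/-- The space of paths which start in `S` and are contained in `V` at all positive times. For
`V = Sᶜ` this is the homotopy link of `S`. -/
def exitPaths (S V : Set Z) : Set C(I, Z) := {γ | γ 0 ∈ S ∧ ∀ u, 0 < u → γ u ∈ V}

/-- Postcomposition with a map which carries `S` to `T` and `V` to `V'`, on spaces of exit paths. -/
def exitPaths.map {S V : Set Z} {T V' : Set W} (φ : C(Z, W)) (hS : ∀ z ∈ S, φ z ∈ T)
    (hV : ∀ z ∈ V, φ z ∈ V') : C(exitPaths S V, exitPaths T V') where
  toFun γ := ⟨φ.comp γ.1, hS _ γ.2.1, fun u hu => hV _ (γ.2.2 u hu)⟩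
  continuous_toFun := Continuous.subtype_mk
    ((ContinuousMap.continuous_postcomp φ).comp continuous_subtype_val) _

end ExitPaths

namespace MappingCylinderNhd

variable {Z : Type*} [TopologicalSpace Z] {S : Set Z} (N : MappingCylinderNhd S)

instance [CompactSpace Z] : CompactSpace N.Boundary :=
  isCompact_iff_compactSpace.1 isClosed_frontier.isCompact

theorem cyl_mem (b : N.Boundary) {t : I} (ht : 0 < t) : N.cyl (b, t) ∈ N.carrier \ S :=
  N.image_cyl ▸ Set.mem_image_of_mem _ ht

theorem cyl_mem_carrier (b : N.Boundary) (t : I) : N.cyl (b, t) ∈ N.carrier := by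
  rcases eq_or_lt_of_le (unitInterval.nonneg' (t := t)) with h | h
  · exact interior_subset (N.subset_interior (h ▸ N.cyl_zero_mem b))
  · exact (N.cyl_mem b h).1

theorem exists_coord (z : (N.carrier \ S : Set Z)) : ∃ p : N.Boundary × I, 0 < p.2 ∧ N.cyl p = z :=
  N.image_cyl.ge z.2

/-- The cylinder coordinates of a point of `N \ S`. -/
noncomputable def coord (z : (N.carrier \ S : Set Z)) : N.Boundary × I := (N.exists_coord z).choose

theorem coord_pos (z : (N.carrier \ S : Set Z)) : 0 < (N.coord z).2 := (N.exists_coord z).choose_spec.1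

theorem cyl_coord (z : (N.carrier \ S : Set Z)) : N.cyl (N.coord z) = z :=
  (N.exists_coord z).choose_spec.2

theorem coord_eq {z : (N.carrier \ S : Set Z)} {p : N.Boundary × I} (hp : 0 < p.2)
    (h : N.cyl p = z) : N.coord z = p :=
  N.injOn_cyl (N.coord_pos z) hp ((N.cyl_coord z).trans h.symm)

variable [CompactSpace Z] [T2Space Z]

theorem continuous_coord : Continuous N.coord := by
  have hU : ∀ p, p ∈ N.cyl ⁻¹' Sᶜ ↔ 0 < p.2 := by
    rintro ⟨b, t⟩
    refine ⟨fun h => ?_, fun h => (N.cyl_mem b h).2⟩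
    rcases eq_or_lt_of_le (unitInterval.nonneg' (t := t)) with h' | h'
    · obtain rfl : 0 = t := h'
      exact absurd (N.cyl_zero_mem b) h
    · exact h'
  have hc : IsClosedEmbedding (Sᶜ.restrictPreimage N.cyl) :=
    .of_continuous_injective_isClosedMap (N.cyl.continuous.restrictPreimage)
      (fun p q h => Subtype.ext (N.injOn_cyl ((hU _).1 p.2) ((hU _).1 q.2)
        (congrArg Subtype.val h)))
      (N.cyl.continuous.isClosedMap.restrictPreimage _)
  have h1 : Continuous fun z => (⟨N.coord z, (hU _).2 (N.coord_pos z)⟩ : N.cyl ⁻¹' Sᶜ) := by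
    rw [hc.isInducing.continuous_iff]
    have : (Sᶜ.restrictPreimage N.cyl ∘ fun z => ⟨N.coord z, (hU _).2 (N.coord_pos z)⟩) =
        fun z : (N.carrier \ S : Set Z) => (⟨z, z.2.2⟩ : ↑Sᶜ) :=
      funext fun z => Subtype.ext (N.cyl_coord z)
    rw [this]
    fun_prop
  exact continuous_subtype_val.comp h1

open Classical in
/-- The height of a point of `N`: its cylinder coordinate `t`, and `0` on `S`. -/
noncomputable def height (z : N.carrier) : I :=
  if h : (z : Z) ∈ S then 0 else (N.coord ⟨z, z.2, h⟩).2

open Classical in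
/-- The point at height `k` on the cylinder line through `z`; points of `S` are fixed. -/
noncomputable def slide (x : N.carrier × I) : Z :=
  if h : (x.1 : Z) ∈ S then x.1 else N.cyl ((N.coord ⟨x.1, x.1.2, h⟩).1, x.2)

theorem continuous_height (hS : IsClosed S) : Continuous N.height := by
  rw [continuous_iff_continuousAt]
  intro z
  by_cases hz : (z : Z) ∈ S
  · have h0 : N.height z = 0 := by simp [height, hz]
    rw [ContinuousAt, h0]
    refine tendsto_order.2 ⟨fun a ha => absurd ha (not_lt.2 unitInterval.nonneg'), fun a ha => ?_⟩
    have hcl : IsClosed (N.cyl '' {p | a ≤ p.2}) :=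
      N.cyl.continuous.isClosedMap _ (isClosed_le continuous_const continuous_snd)
    have hzn : (z : Z) ∉ N.cyl '' {p | a ≤ p.2} := by
      rintro ⟨⟨b, t⟩, ht, h⟩
      exact (N.cyl_mem b (ha.trans_le ht)).2 (h ▸ hz)
    filter_upwards [(hcl.preimage continuous_subtype_val).isOpen_compl.mem_nhds
      (show z ∈ (Subtype.val ⁻¹' (N.cyl '' {p | a ≤ p.2}))ᶜ from hzn)] with y hy
    by_cases hyS : (y : Z) ∈ S
    · simpa [height, hyS] using ha
    · by_contra hlt
      refine hy ⟨N.coord ⟨y, y.2, hyS⟩, ?_, N.cyl_coord _⟩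
      simpa [height, hyS] using hlt
  · have ho : IsOpen {y : N.carrier | (y : Z) ∉ S} := hS.isOpen_compl.preimage continuous_subtype_val
    refine ContinuousOn.continuousAt (s := {y : N.carrier | (y : Z) ∉ S}) ?_ (ho.mem_nhds hz)
    rw [continuousOn_iff_continuous_domRestrict]
    have : Set.domRestrict {y : N.carrier | (y : Z) ∉ S} N.height =
        fun y => (N.coord ⟨y.1, y.1.2, y.2⟩).2 := by
      ext y
      have := y.2
      simp only [Set.mem_ofPred_eq] at this
      simp [height, this]
    rw [this]
    exact continuous_snd.comp (N.continuous_coord.comp (by fun_prop))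

omit [CompactSpace Z] [T2Space Z] in
theorem cyl_height {z : N.carrier} (hz : (z : Z) ∉ S) :
    N.cyl ((N.coord ⟨z, z.2, hz⟩).1, N.height z) = z := by
  have : N.height z = (N.coord ⟨z, z.2, hz⟩).2 := by simp [height, hz]
  rw [this]
  exact N.cyl_coord _

omit [CompactSpace Z] [T2Space Z] in
theorem slide_height (z : N.carrier) : N.slide (z, N.height z) = z := by
  by_cases hz : (z : Z) ∈ S
  · simp [slide, hz]
  · simpa [slide, hz] using N.cyl_height hz

theorem slide_continuousAt (hS : IsClosed S) (x : N.carrier × I)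
    (hx : (x.1 : Z) ∈ S → x.2 = 0) : ContinuousAt N.slide x := by
  obtain ⟨z, k⟩ := x
  by_cases hz : (z : Z) ∈ S
  · obtain rfl : k = 0 := hx hz
    have h0 : N.slide (z, 0) = z := by simp [slide, hz]
    rw [ContinuousAt, h0]
    intro U hU
    obtain ⟨V, hVU, hV, hzV⟩ := mem_nhds_iff.1 hU
    -- Points at small heights on a line meeting a small neighborhood of `z` at a small height.
    let F : N.Boundary × I × I → Z × I × I := fun q => (N.cyl (q.1, q.2.1), q.2)
    have hF : IsClosedMap F := (show Continuous F by fun_prop).isClosedMap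
    have hcl : IsClosed (F '' {q | N.cyl (q.1, q.2.2) ∉ V}) :=
      hF _ (hV.isClosed_compl.preimage (by fun_prop))
    have hn : ((z : Z), (0 : I), (0 : I)) ∉ F '' {q | N.cyl (q.1, q.2.2) ∉ V} := by
      rintro ⟨⟨b, u, k⟩, hq, h⟩
      simp only [F, Prod.mk.injEq] at h
      obtain ⟨h1, rfl, rfl⟩ := h
      exact hq (h1 ▸ hzV)
    have hcont : Continuous fun y : N.carrier × I => ((y.1 : Z), N.height y.1, y.2) := by
      have := N.continuous_height hS
      fun_prop
    have hz0 : N.height z = 0 := by simp [height, hz]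
    have hmem : {y : N.carrier × I | ((y.1 : Z), N.height y.1, y.2) ∉
        F '' {q | N.cyl (q.1, q.2.2) ∉ V}} ∈ 𝓝 (z, (0 : I)) :=
      (hcl.isOpen_compl.preimage hcont).mem_nhds (by simpa [hz0] using hn)
    have hV' : {y : N.carrier × I | (y.1 : Z) ∈ V} ∈ 𝓝 (z, (0 : I)) :=
      (hV.preimage (by fun_prop : Continuous fun y : N.carrier × I => (y.1 : Z))).mem_nhds hzV
    rw [Filter.mem_map]
    filter_upwards [hmem, hV'] with y hy hyV
    refine hVU ?_
    by_cases hyS : (y.1 : Z) ∈ S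
    · simpa [slide, hyS] using hyV
    · by_contra hns
      refine hy ⟨((N.coord ⟨y.1, y.1.2, hyS⟩).1, N.height y.1, y.2), ?_, ?_⟩
      · simpa [slide, hyS] using hns
      · simp [F, N.cyl_height hyS]
  · have ho : IsOpen {y : N.carrier × I | (y.1 : Z) ∉ S} :=
      hS.isOpen_compl.preimage (by fun_prop : Continuous fun y : N.carrier × I => (y.1 : Z))
    refine ContinuousOn.continuousAt (s := {y : N.carrier × I | (y.1 : Z) ∉ S}) ?_ (ho.mem_nhds hz)
    rw [continuousOn_iff_continuous_domRestrict]
    have : Set.domRestrict {y : N.carrier × I | (y.1 : Z) ∉ S} N.slide =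
        fun y => N.cyl ((N.coord ⟨y.1.1, y.1.1.2, y.2⟩).1, y.1.2) := by
      ext y
      have := y.2
      simp only [Set.mem_ofPred_eq] at this
      simp [slide, this]
    rw [this]
    have := N.continuous_coord
    fun_prop

/-- The exit paths which stay in `N` up to time `δ`. -/
def nearPaths (δ : I) : Set C(I, Z) := {γ | γ ∈ exitPaths S Sᶜ ∧ ∀ t ≤ δ, γ t ∈ N.carrier}

/-- The lines of the cylinder, as exit paths. -/
def line (δ : I) : C(N.Boundary, N.nearPaths δ) where
  toFun b := ⟨N.cyl.curry b, ⟨N.cyl_zero_mem b, fun _ hu => (N.cyl_mem b hu).2⟩,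
    fun t _ => N.cyl_mem_carrier b t⟩
  continuous_toFun := Continuous.subtype_mk N.cyl.curry.continuous _

/-- The projection along the cylinder lines of the point of a path at time `δ`. -/
noncomputable def proj {δ : I} (hδ : 0 < δ) : C(N.nearPaths δ, N.Boundary) where
  toFun γ := (N.coord ⟨γ.1 δ, γ.2.2 δ le_rfl, γ.2.1.2 δ hδ⟩).1
  continuous_toFun := by
    have := N.continuous_coord
    fun_prop

theorem proj_line {δ : I} (hδ : 0 < δ) : (N.proj hδ).comp (N.line δ) = ContinuousMap.id _ := by
  ext1 b
  exact congrArg Prod.fst (N.coord_eq (p := (b, δ)) hδ rfl)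

/-- Traversing a path at the speed `δ`. -/
def slow (δ : I) (hδ : 0 < δ) (δ' : I) : C(N.nearPaths δ, N.nearPaths δ') where
  toFun γ := ⟨γ.1.comp ⟨fun t => δ * t, by fun_prop⟩, ⟨by simpa using γ.2.1.1, fun _ hu =>
    γ.2.1.2 _ (by
      rw [← Subtype.coe_lt_coe] at hu hδ ⊢
      exact mul_pos hδ hu)⟩, fun t _ => γ.2.2 _ (by
      rw [← Subtype.coe_le_coe]
      exact mul_le_of_le_one_right δ.2.1 t.2.2)⟩
  continuous_toFun := Continuous.subtype_mk
    ((ContinuousMap.continuous_precomp _).comp continuous_subtype_val) _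

omit [CompactSpace Z] [T2Space Z] in
theorem slow_homotopic {δ : I} (hδ : 0 < δ) :
    (N.slow δ hδ δ).Homotopic (ContinuousMap.id _) := by
  -- The speed at time `τ` of the homotopy.
  let s : I → I := fun τ => max δ τ
  have hs : Continuous s := by fun_prop
  let F : C((I × N.nearPaths δ) × I, Z) := ⟨fun x => x.1.2.1 (s x.1.1 * x.2), by fun_prop⟩
  refine ⟨⟨⟨fun x => ⟨F.curry x, ⟨?_, fun u hu => ?_⟩, fun t ht => ?_⟩, ?_⟩, fun γ => ?_,
    fun γ => ?_⟩⟩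
  · simpa [F] using x.2.2.1.1
  · refine x.2.2.1.2 _ ?_
    rw [← Subtype.coe_lt_coe] at hu hδ ⊢
    exact mul_pos (hδ.trans_le (Subtype.coe_le_coe.2 (le_max_left δ x.1))) hu
  · refine x.2.2.2 _ (le_trans ?_ ht)
    rw [← Subtype.coe_le_coe]
    exact mul_le_of_le_one_left t.2.1 (s x.1).2.2
  · exact Continuous.subtype_mk F.curry.continuous _
  · refine Subtype.ext (ContinuousMap.ext fun t => ?_)
    simp [F, s, slow]
  · refine Subtype.ext (ContinuousMap.ext fun t => ?_)
    have : max δ 1 = 1 := max_eq_right unitInterval.le_one'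
    simp [F, s, this]

theorem line_proj_homotopic_one (hS : IsClosed S) :
    (ContinuousMap.id _).Homotopic ((N.line 1).comp (N.proj (δ := 1) zero_lt_one)) := by
  -- At time `τ`, the path is at its height at time `t` deformed to `t`, on the line through the
  -- point of the path at time `max t τ`.
  let k : (I × N.nearPaths 1) × I → I := fun x => Set.projIcc (0 : ℝ) 1 zero_le_one
    ((1 - x.1.1) * N.height ⟨x.1.2.1 x.2, x.1.2.2.2 _ unitInterval.le_one'⟩ + x.1.1 * x.2)
  have hk' : ∀ x, (k x : ℝ) =
      (1 - x.1.1) * N.height ⟨x.1.2.1 x.2, x.1.2.2.2 _ unitInterval.le_one'⟩ + x.1.1 * x.2 := by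
    intro x
    refine congrArg Subtype.val (Set.projIcc_of_mem zero_le_one ⟨?_, ?_⟩)
    · have h1 := x.1.1.2
      have h2 := (N.height ⟨x.1.2.1 x.2, x.1.2.2.2 _ unitInterval.le_one'⟩).2
      have h3 := x.2.2
      have := mul_nonneg h1.1 h3.1
      have := mul_nonneg (sub_nonneg.2 h1.2) h2.1
      linarith
    · have h1 := x.1.1.2
      have h2 := (N.height ⟨x.1.2.1 x.2, x.1.2.2.2 _ unitInterval.le_one'⟩).2
      have h3 := x.2.2
      have := mul_le_of_le_one_right h1.1 h3.2
      have := mul_le_of_le_one_right (sub_nonneg.2 h1.2) h2.2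
      linarith
  have hk : Continuous k := by
    have := N.continuous_height hS
    exact continuous_projIcc.comp (by fun_prop)
  let m : (I × N.nearPaths 1) × I → N.carrier :=
    fun x => ⟨x.1.2.1 (max x.2 x.1.1), x.1.2.2.2 _ unitInterval.le_one'⟩
  have hm : Continuous m := by fun_prop
  have hheight : ∀ γ : N.nearPaths 1, N.height ⟨γ.1 0, γ.2.2 _ unitInterval.le_one'⟩ = 0 :=
    fun γ => by simp [height, γ.2.1.1]
  have hpos : ∀ (γ : N.nearPaths 1) (t : I), 0 < t →
      0 < N.height ⟨γ.1 t, γ.2.2 _ unitInterval.le_one'⟩ := fun γ t ht => by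
    have hn : γ.1 t ∉ S := γ.2.1.2 t ht
    simpa [height, hn] using N.coord_pos _
  have hmS : ∀ x, (m x : Z) ∈ S → x.2 = 0 ∧ x.1.1 = 0 := fun x hx => by
    have : max x.2 x.1.1 = 0 := by
      by_contra hne
      exact x.1.2.2.1.2 _ (unitInterval.pos_iff_ne_zero.2 hne) hx
    have h1 := le_max_left x.2 x.1.1
    have h2 := le_max_right x.2 x.1.1
    rw [this] at h1 h2
    exact ⟨le_antisymm h1 unitInterval.nonneg', le_antisymm h2 unitInterval.nonneg'⟩
  have kzero : ∀ x, x.2 = 0 → k x = 0 := fun x hx => by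
    refine Subtype.ext ?_
    rw [hk', hx, hheight]
    simp
  have kpos : ∀ x, 0 < x.2 → 0 < k x := fun x hx => by
    rw [← Subtype.coe_lt_coe, hk']
    have h1 := x.1.1.2
    have h2 := Subtype.coe_lt_coe.2 (hpos x.1.2 x.2 hx)
    have h3 := Subtype.coe_lt_coe.2 hx
    simp only [Set.Icc.coe_zero] at h2 h3 ⊢
    rcases eq_or_lt_of_le h1.1 with h0 | h0
    · rw [← h0]; simpa using h2
    · have := mul_pos h0 h3
      have := mul_nonneg (sub_nonneg.2 h1.2) h2.le
      linarith
  let F : C((I × N.nearPaths 1) × I, Z) := ⟨fun x => N.slide (m x, k x),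
    continuous_iff_continuousAt.2 fun x => ContinuousAt.comp (g := N.slide) (f := fun x => (m x, k x))
      (N.slide_continuousAt hS _ fun h => kzero _ (hmS x h).1) (by fun_prop)⟩
  have hF : ∀ x (h : (m x : Z) ∉ S), F x = N.cyl ((N.coord ⟨m x, (m x).2, h⟩).1, k x) := by
    intro x h
    simp [F, slide, h]
  have hF' : ∀ x, (m x : Z) ∈ S → F x = m x := by
    intro x h
    simp [F, slide, h]
  refine ⟨⟨⟨fun x => ⟨F.curry x, ⟨?_, fun u hu => ?_⟩, fun t _ => ?_⟩, ?_⟩, fun γ => ?_,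
    fun γ => ?_⟩⟩
  · change F (x, 0) ∈ S
    by_cases h : (m (x, 0) : Z) ∈ S
    · rw [hF' _ h]; exact h
    · rw [hF _ h, kzero _ rfl]
      exact N.cyl_zero_mem _
  · change F (x, u) ∉ S
    have h : (m (x, u) : Z) ∉ S := fun h => hu.ne' (hmS _ h).1
    rw [hF _ h]
    exact (N.cyl_mem _ (kpos (x, u) hu)).2
  · change F (x, t) ∈ N.carrier
    by_cases h : (m (x, t) : Z) ∈ S
    · rw [hF' _ h]; exact (m (x, t)).2
    · rw [hF _ h]
      exact N.cyl_mem_carrier _ _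
  · exact Continuous.subtype_mk F.curry.continuous _
  · refine Subtype.ext (ContinuousMap.ext fun t => ?_)
    change N.slide (m ((0, γ), t), k ((0, γ), t)) = γ.1 t
    have h1 : m ((0, γ), t) = ⟨γ.1 t, γ.2.2 _ unitInterval.le_one'⟩ := by
      simp [m]
    have h2 : k ((0, γ), t) = N.height ⟨γ.1 t, γ.2.2 _ unitInterval.le_one'⟩ := by
      refine Subtype.ext ?_
      rw [hk']
      simp
    rw [h1, h2, N.slide_height]
  · refine Subtype.ext (ContinuousMap.ext fun t => ?_)
    change F ((1, γ), t) = N.cyl (_, t)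
    have h1 : m ((1, γ), t) = ⟨γ.1 1, γ.2.2 _ unitInterval.le_one'⟩ := by
      simp [m, max_eq_right (unitInterval.le_one' (t := t))]
    have h2 : k ((1, γ), t) = t := by
      refine Subtype.ext ?_
      rw [hk']
      simp
    rw [hF _ (fun h => one_ne_zero (hmS _ h).2), h2]
    simp only [h1]
    rfl

theorem line_proj_homotopic (hS : IsClosed S) {δ : I} (hδ : 0 < δ) :
    ((N.line δ).comp (N.proj hδ)).Homotopic (ContinuousMap.id _) := by
  let ι : C(N.nearPaths 1, N.nearPaths δ) :=
    ⟨fun γ => ⟨γ.1, γ.2.1, fun t _ => γ.2.2 t unitInterval.le_one'⟩,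
      Continuous.subtype_mk continuous_subtype_val _⟩
  have h := ((ContinuousMap.Homotopic.refl ι).comp (N.line_proj_homotopic_one hS)).comp
    (ContinuousMap.Homotopic.refl (N.slow δ hδ 1))
  have h1 : (ι.comp (ContinuousMap.id _)).comp (N.slow δ hδ 1) = N.slow δ hδ δ := rfl
  have h2 : (ι.comp ((N.line 1).comp (N.proj (δ := 1) zero_lt_one))).comp (N.slow δ hδ 1) =
      (N.line δ).comp (N.proj hδ) := by
    have : ∀ γ, N.proj (δ := 1) zero_lt_one (N.slow δ hδ 1 γ) = N.proj hδ γ := fun γ => by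
      simp only [proj, slow, ContinuousMap.coe_mk, ContinuousMap.comp_apply, mul_one]
    ext γ t
    change N.cyl (N.proj (δ := 1) zero_lt_one (N.slow δ hδ 1 γ), t) = N.cyl (N.proj hδ γ, t)
    rw [this]
  rw [h1, h2] at h
  exact h.symm.trans (N.slow_homotopic hδ)

theorem hasHELP_line (hS : IsClosed S) {δ : I} (hδ : 0 < δ) : HasHELP (N.line δ) := by
  refine (IsMappingPathFull.of_isHomotopyEquiv ⟨⟨N.line δ, N.proj hδ, ?_, ?_⟩, rfl⟩).hasHELP
  · rw [N.proj_line hδ]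
  · exact N.line_proj_homotopic hS hδ

omit [CompactSpace Z] in
theorem exists_nearPaths {P : Type*} [TopologicalSpace P] [CompactSpace P]
    (b : C(P, exitPaths S Sᶜ)) : ∃ δ : I, 0 < δ ∧ ∀ p, (b p).1 ∈ N.nearPaths δ := by
  have ho : IsOpen {x : I × P | (b x.2).1 x.1 ∈ interior N.carrier} :=
    isOpen_interior.preimage (by fun_prop)
  obtain ⟨U, V, hU, -, h0, hV, hUV⟩ := generalized_tube_lemma (isCompact_singleton (x := (0 : I)))
    (isCompact_univ (X := P)) ho (by
      rintro ⟨t, p⟩ ⟨ht, -⟩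
      obtain rfl : t = 0 := ht
      exact N.subset_interior (b p).2.1)
  have hU0 : U ∈ 𝓝 (0 : I) := hU.mem_nhds (h0 rfl)
  obtain ⟨a, ha, haU⟩ := exists_Ico_subset_of_mem_nhds hU0 ⟨1, zero_lt_one⟩
  obtain ⟨δ, hδ, hδa⟩ := exists_between ha
  exact ⟨δ, hδ, fun p => ⟨(b p).2, fun t ht => interior_subset (@hUV (t, p)
    ⟨haU ⟨unitInterval.nonneg', ht.trans_lt hδa⟩, hV (Set.mem_univ p)⟩)⟩⟩

/-- The inclusion of `nearPaths` into the homotopy link. -/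
def nearInclusion (δ : I) : C(N.nearPaths δ, exitPaths S Sᶜ) :=
  ⟨fun γ => ⟨γ.1, γ.2.1⟩, Continuous.subtype_mk continuous_subtype_val _⟩

/-- The lines of the cylinder capture all compact families of exit paths, since these stay in `N` up
to a common time. -/
theorem hasHELP_line_exitPaths (hS : IsClosed S) :
    HasHELP ((N.nearInclusion 1).comp (N.line 1)) := by
  intro P _ _ _ A hA α b hb
  obtain ⟨δ, hδ, hb'⟩ := N.exists_nearPaths b
  obtain ⟨a, ha, H⟩ := N.hasHELP_line hS hδ P A hA α
    ⟨fun p => ⟨(b p).1, hb' p⟩, Continuous.subtype_mk (by fun_prop) _⟩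
    (fun p => Subtype.ext (show (b p).1 = _ from congrArg Subtype.val (hb p)))
  exact ⟨a, ha, H.comp_continuousMap (N.nearInclusion δ)⟩

variable {W : Type*} [TopologicalSpace W] [CompactSpace W] [T2Space W] {T : Set W}

/-- A map which induces a homotopy equivalence between the boundaries of mapping cylinder
neighborhoods induces an equivalence of homotopy links. -/
theorem hasHELP_exitPaths (hS : IsClosed S) (hT : IsClosed T) (M : MappingCylinderNhd T)
    (φ : C(Z, W)) (h₁ : ∀ z ∈ S, φ z ∈ T) (h₂ : ∀ z ∈ Sᶜ, φ z ∈ Tᶜ) {g : C(N.Boundary, M.Boundary)}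
    (hg : N.InducedOnBoundary M φ g) (he : IsHomotopyEquiv g) :
    HasHELP (exitPaths.map φ h₁ h₂) := by
  obtain ⟨ε, hε, hN, hgε⟩ := hg
  refine IsMappingPathFull.hasHELP (IsMappingPathFull.of_comp
    (f := (N.nearInclusion 1).comp (N.line 1)) ?_ (N.hasHELP_line_exitPaths hS).isMappingPathFull)
  refine ((M.hasHELP_line_exitPaths hT).isMappingPathFull.comp
    (IsMappingPathFull.of_isHomotopyEquiv he)).of_homotopic ?_
  -- The images under `φ` of the lines of `N` stay in `M` up to time `ε`.
  let j : C(N.Boundary, M.nearPaths ε) :=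
    ⟨fun b => ⟨φ.comp (N.cyl.curry b), (exitPaths.map φ h₁ h₂ (N.nearInclusion 1 (N.line 1 b))).2,
      fun t ht => by
        rcases eq_or_lt_of_le (unitInterval.nonneg' (t := t)) with h | h
        · obtain rfl : 0 = t := h
          exact interior_subset (M.subset_interior (h₁ _ (N.cyl_zero_mem b)))
        · exact (hN b t h ht).1⟩,
      Continuous.subtype_mk ((ContinuousMap.continuous_postcomp φ).comp N.cyl.curry.continuous) _⟩
  have hj : (M.proj hε).comp j = g := by
    ext1 b
    obtain ⟨s, hs, h⟩ := hgε b
    exact congrArg Prod.fst (M.coord_eq (p := (g b, s)) hs h.symm)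
  have := ((ContinuousMap.Homotopic.refl (M.nearInclusion ε)).comp
    (M.line_proj_homotopic hT hε)).comp (ContinuousMap.Homotopic.refl j)
  rw [ContinuousMap.comp_assoc, ContinuousMap.comp_assoc, hj] at this
  exact this

end MappingCylinderNhd

/-! ### The initial point of exit paths as a fibration -/

section Translation

variable {X B : Type*} [TopologicalSpace X] [TopologicalSpace B]

/-- Near each point of `S` there is a chart with values in `E` in which the translations by the
differences of points of `S` preserve `V`. -/
def HasTranslationCharts (E : Type*) [TopologicalSpace E] [AddCommGroup E] (S V : Set X) : Prop :=
  ∀ s ∈ S, ∃ e : OpenPartialHomeomorph X E, s ∈ e.source ∧ ∀ z ∈ V, ∀ a ∈ S, ∀ b ∈ S,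
    z ∈ e.source → a ∈ e.source → b ∈ e.source → e z + (e b - e a) ∈ e.target →
      e.symm (e z + (e b - e a)) ∈ V

/-- Points `z` near `m b` can be moved, continuously in `b` and `z`, such that `m b` is moved to
`m' b`, the set `V` is preserved, and nothing is moved if `b ∈ D`. -/
def IsMovable (V : Set X) (D : Set B) (m m' : B → X) : Prop :=
  ∃ (O : Set (B × X)) (F : B × X → X), IsOpen O ∧ (∀ b, (b, m b) ∈ O) ∧ ContinuousOn F O ∧
    (∀ b, F (b, m b) = m' b) ∧ (∀ b z, (b, z) ∈ O → z ∈ V → F (b, z) ∈ V) ∧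
    ∀ b ∈ D, ∀ z, F (b, z) = z

variable {V : Set X} {D : Set B}

theorem IsMovable.refl (m : B → X) : IsMovable V D m m :=
  ⟨Set.univ, Prod.snd, isOpen_univ, fun _ => trivial, continuous_snd.continuousOn, fun _ => rfl,
    fun _ _ _ h => h, fun _ _ _ => rfl⟩

theorem IsMovable.trans {m₁ m₂ m₃ : B → X} (h : IsMovable V D m₁ m₂) (h' : IsMovable V D m₂ m₃) :
    IsMovable V D m₁ m₃ := by
  obtain ⟨O, F, hO, hm, hF, hF1, hF2, hF3⟩ := h
  obtain ⟨O', F', hO', hm', hF', hF1', hF2', hF3'⟩ := h'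
  have hG : ContinuousOn (fun x : B × X => (x.1, F x)) O := continuousOn_fst.prodMk hF
  refine ⟨O ∩ (fun x => (x.1, F x)) ⁻¹' O', fun x => F' (x.1, F x), hG.isOpen_inter_preimage hO hO',
    fun b => ⟨hm b, ?_⟩, hF'.comp (hG.mono Set.inter_subset_left) (fun x hx => hx.2), fun b => ?_,
    fun b z hz hzV => hF2' _ _ hz.2 (hF2 _ _ hz.1 hzV), fun b hb z => ?_⟩
  · simpa [hF1] using hm' b
  · simp [hF1, hF1']
  · simp [hF3 b hb, hF3' b hb]

theorem ContinuousOn.of_isClosed_cover {Y : Type*} [TopologicalSpace Y] {f : B → Y} {O C C' : Set B}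
    (hC : IsClosed C) (hC' : IsClosed C') (hcov : ∀ b, b ∈ C ∨ b ∈ C') (h : ContinuousOn f (O ∩ C))
    (h' : ContinuousOn f (O ∩ C')) : ContinuousOn f O := by
  have hO : O = (O ∩ C) ∪ (O ∩ C') := by
    rw [← Set.inter_union_distrib_left, Set.eq_univ_of_forall (s := C ∪ C') hcov, Set.inter_univ]
  have key : ∀ {K : Set B}, IsClosed K → ContinuousOn f (O ∩ K) → ∀ x ∈ O,
      ContinuousWithinAt f (O ∩ K) x := by
    intro K hK hf x hx
    by_cases hxK : x ∈ K
    · exact hf x ⟨hx, hxK⟩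
    · refine continuousWithinAt_of_notMem_closure fun hc => hxK ?_
      exact hK.closure_subset_iff.2 Set.inter_subset_right hc
  intro x hx
  rw [hO]
  exact (key hC h x hx).union (key hC' h' x hx)

variable {E : Type*} [TopologicalSpace E] [AddCommGroup E] [IsTopologicalAddGroup E]

/-- Moving points by translations in a single chart. -/
theorem isMovable_of_chart [T2Space X] {S : Set X} (e : OpenPartialHomeomorph X E)
    (he : ∀ z ∈ V, ∀ a ∈ S, ∀ b ∈ S, z ∈ e.source → a ∈ e.source → b ∈ e.source →
      e z + (e b - e a) ∈ e.target → e.symm (e z + (e b - e a)) ∈ V)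
    {m m' : B → X} (hm : Continuous m) (hm' : Continuous m') (hmS : ∀ b, m b ∈ S)
    (hmS' : ∀ b, m' b ∈ S) {C : Set B} (hC : IsClosed C) (hCm : ∀ b ∈ C, m b ∈ e.source)
    (hCm' : ∀ b ∈ C, m' b ∈ e.source) (heq : ∀ b ∉ C, m b = m' b) (hD : ∀ b ∈ D, m b = m' b) :
    IsMovable V D m m' := by
  classical
  let W₀ : Set (B × X) := {x | x.2 ∈ e.source ∧ m x.1 ∈ e.source ∧ m' x.1 ∈ e.source}
  let T : B × X → E := fun x => e x.2 + (e (m' x.1) - e (m x.1))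
  have hW₀ : IsOpen W₀ := (e.open_source.preimage continuous_snd).inter
    ((e.open_source.preimage (hm.comp continuous_fst)).inter
      (e.open_source.preimage (hm'.comp continuous_fst)))
  have hT : ContinuousOn T W₀ := by
    refine (e.continuousOn.comp continuousOn_snd fun x hx => hx.1).add
      ((e.continuousOn.comp (hm'.comp continuous_fst).continuousOn fun x hx => hx.2.2).sub
        (e.continuousOn.comp (hm.comp continuous_fst).continuousOn fun x hx => hx.2.1))
  let W : Set (B × X) := W₀ ∩ T ⁻¹' e.target
  have hW : IsOpen W := hT.isOpen_inter_preimage hW₀ e.open_target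
  let F : B × X → X := fun x => if m x.1 = m' x.1 then x.2 else e.symm (T x)
  have hF : ∀ x ∈ W, F x = e.symm (T x) := by
    intro x hx
    by_cases h : m x.1 = m' x.1
    · simp only [F, h, if_true, T, sub_self, add_zero]
      exact (e.left_inv hx.1.1).symm
    · simp [F, h]
  have hF' : ∀ x : B × X, m x.1 = m' x.1 → F x = x.2 := fun x h => by simp [F, h]
  let O : Set (B × X) := {x | x.1 ∉ C} ∪ W
  have hO : IsOpen O := (hC.isOpen_compl.preimage continuous_fst).union hW
  have hOC : ∀ x ∈ O, x.1 ∈ C → x ∈ W := fun x hx hxC => hx.resolve_left (fun h => h hxC)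
  refine ⟨O, F, hO, fun b => ?_, ?_, fun b => ?_, fun b z hbz hz => ?_, fun b hb z => ?_⟩
  · by_cases hb : b ∈ C
    · refine Or.inr ⟨⟨hCm b hb, hCm b hb, hCm' b hb⟩, ?_⟩
      simpa [T] using e.map_source (hCm' b hb)
    · exact Or.inl hb
  · refine ContinuousOn.of_isClosed_cover (C := {x | x.1 ∈ C}) (C' := {x | m x.1 = m' x.1})
      (hC.preimage continuous_fst)
      (isClosed_eq (hm.comp continuous_fst) (hm'.comp continuous_fst)) (fun x => ?_) ?_ ?_
    · by_cases h : x.1 ∈ C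
      · exact Or.inl h
      · exact Or.inr (heq _ h)
    · have hsub : O ∩ {x | x.1 ∈ C} ⊆ W := fun x hx => hOC x hx.1 hx.2
      refine ContinuousOn.congr ?_ fun x hx => hF x (hsub hx)
      exact (e.continuousOn_symm.comp (hT.mono Set.inter_subset_left) (fun x hx => hx.2)).mono hsub
    · exact continuousOn_snd.congr fun x hx => hF' x hx.2
  · by_cases h : m b = m' b
    · rw [hF' (b, m b) h, h]
    · have hb : b ∈ C := by_contra fun hb => h (heq b hb)
      simp only [F, h, if_false, T, add_sub_cancel]
      exact e.left_inv (hCm' b hb)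
  · by_cases h : m b = m' b
    · rw [hF' (b, z) h]
      exact hz
    · have hb : b ∈ C := by_contra fun hb => h (heq b hb)
      have hx := hOC _ hbz hb
      rw [hF _ hx]
      exact he z hz _ (hmS b) _ (hmS' b) hx.1.1 hx.1.2.1 hx.1.2.2 hx.2
  · exact hF' (b, z) (hD b hb)

/-- Moving points along a family of paths, each of which stays in a chart. -/
theorem isMovable_of_small [T2Space X] [CompactSpace B] [T2Space B] {S : Set X}
    (ζ : C(B × I, X)) (hζS : ∀ x, ζ x ∈ S)
    (hζ : ∀ b, ∃ e : OpenPartialHomeomorph X E, (∀ t, ζ (b, t) ∈ e.source) ∧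
      ∀ z ∈ V, ∀ a ∈ S, ∀ b ∈ S, z ∈ e.source → a ∈ e.source → b ∈ e.source →
        e z + (e b - e a) ∈ e.target → e.symm (e z + (e b - e a)) ∈ V)
    (hD : ∀ b ∈ D, ∀ t, ζ (b, t) = ζ (b, 0)) :
    IsMovable V D (fun b => ζ (b, 0)) (fun b => ζ (b, 1)) := by
  choose e he₁ he₂ using hζ
  have hU : ∀ b, ∃ U : Set B, IsOpen U ∧ b ∈ U ∧ ∀ b' ∈ U, ∀ t, ζ (b', t) ∈ (e b).source := by
    intro b
    obtain ⟨U, U', hU, -, hbU, hU', hUU⟩ := generalized_tube_lemma (isCompact_singleton (x := b))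
      (isCompact_univ (X := I)) ((e b).open_source.preimage ζ.continuous) (by
        rintro ⟨b', t⟩ ⟨hb, -⟩
        obtain rfl : b' = b := hb
        exact he₁ b' t)
    exact ⟨U, hU, hbU rfl, fun b' hb' t => hUU (Set.mk_mem_prod hb' (hU' (Set.mem_univ t)))⟩
  choose U hUo hbU hUe using hU
  obtain ⟨ρ, hρ⟩ := PartitionOfUnity.exists_isSubordinate isClosed_univ U hUo
    (fun b _ => Set.mem_iUnion.2 ⟨b, hbU b⟩)
  have hfin : {i | (Function.support (ρ i)).Nonempty}.Finite :=
    ρ.locallyFinite.finite_nonempty_of_compact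
  have hsum : ∀ b, ∑ i ∈ hfin.toFinset, ρ i b = 1 := fun b => by
    rw [← ρ.sum_eq_one (Set.mem_univ b)]
    refine (finsum_eq_sum_of_support_subset _ fun i hi => ?_).symm
    exact hfin.mem_toFinset.2 ⟨b, hi⟩
  -- The time up to which the point `b` has been moved, after the charts in `J` have been used.
  let θ : Finset B → B → I := fun J b => Set.projIcc (0 : ℝ) 1 zero_le_one (∑ i ∈ J, ρ i b)
  have hθ : ∀ J, Continuous (θ J) := fun J => continuous_projIcc.comp (by fun_prop)
  have main : ∀ J : Finset B, IsMovable V D (fun b => ζ (b, 0)) (fun b => ζ (b, θ J b)) := by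
    classical
    intro J
    induction J using Finset.induction_on with
    | empty =>
      have : ∀ b, θ ∅ b = 0 := fun b => by
        simp [θ]
      simp only [this]
      exact IsMovable.refl _
    | insert i J hi ih =>
      refine ih.trans (isMovable_of_chart (S := S) (e i) (he₂ i) (C := tsupport (ρ i)) (by fun_prop)
        (by fun_prop) (fun b => hζS _) (fun b => hζS _) (isClosed_tsupport _)
        (fun b hb => hUe i b (hρ i hb) _) (fun b hb => hUe i b (hρ i hb) _) (fun b hb => ?_)
        fun b hb => ?_)
      · have : ρ i b = 0 := by
          by_contra h
          exact hb (subset_tsupport _ h)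
        simp [θ, Finset.sum_insert hi, this]
      · rw [hD b hb, hD b hb (θ _ b)]
  have h1 : ∀ b, θ hfin.toFinset b = 1 := fun b => by
    simp only [θ, hsum]
    exact Set.projIcc_right (zero_le_one (α := ℝ))
  simpa only [h1] using main hfin.toFinset

/-- Moving points along an arbitrary family of paths. -/
theorem isMovable_of_paths [T2Space X] {Q : Type*} [TopologicalSpace Q] [CompactSpace Q] [T2Space Q]
    {S : Set X} (hSV : HasTranslationCharts E S V) (η : C(Q × I, X)) (hη : ∀ x, η x ∈ S) :
    IsMovable V {x : Q × I | x.2 = 0 ∨ ∀ t, η (x.1, t) = η (x.1, 0)} (fun x => η (x.1, 0)) η := by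
  -- Within times `1 / (n + 1)`, each path stays in a chart.
  let G : ℕ → Set (Q × I) := fun n => interior {x | ∃ e : OpenPartialHomeomorph X E,
    (∀ t : I, |(t : ℝ) - x.2| ≤ 1 / (n + 1) → η (x.1, t) ∈ e.source) ∧
      ∀ z ∈ V, ∀ a ∈ S, ∀ b ∈ S, z ∈ e.source → a ∈ e.source → b ∈ e.source →
        e z + (e b - e a) ∈ e.target → e.symm (e z + (e b - e a)) ∈ V}
  have hmono : Monotone G := by
    intro n n' hn
    refine interior_mono ?_
    rintro x ⟨e, he, he'⟩
    exact ⟨e, fun t ht => he t (ht.trans (one_div_le_one_div_of_le (by positivity) (by gcongr))), he'⟩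
  obtain ⟨n, hn⟩ := isCompact_univ.elim_directed_cover G (fun _ => isOpen_interior) (by
    rintro ⟨q, t₀⟩ -
    obtain ⟨e, he, he'⟩ := hSV _ (hη (q, t₀))
    have hU : η ⁻¹' e.source ∈ 𝓝 (q, t₀) := (e.open_source.preimage η.continuous).mem_nhds he
    rw [nhds_prod_eq] at hU
    obtain ⟨U₁, h₁, U₂, h₂, hUU⟩ := Filter.mem_prod_iff.1 hU
    obtain ⟨ε, hε, hεU⟩ := Metric.mem_nhds_iff.1 h₂
    obtain ⟨n, hn⟩ := exists_nat_one_div_lt (half_pos hε)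
    refine Set.mem_iUnion.2 ⟨n, mem_interior_iff_mem_nhds.2 ?_⟩
    rw [nhds_prod_eq]
    refine Filter.mem_prod_iff.2 ⟨U₁, h₁, Metric.ball t₀ (ε / 2), Metric.ball_mem_nhds _ (half_pos hε),
      ?_⟩
    rintro ⟨q', t'⟩ ⟨hq', ht'⟩
    refine ⟨e, fun t ht => hUU (Set.mk_mem_prod hq' (hεU ?_)), he'⟩
    have h1 : |(t' : ℝ) - t₀| < ε / 2 := ht'
    change |(t : ℝ) - t₀| < ε
    calc |(t : ℝ) - t₀| ≤ |(t : ℝ) - t'| + |(t' : ℝ) - t₀| := abs_sub_le _ _ _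
      _ < ε := by
        have : |(t : ℝ) - t'| ≤ 1 / (n + 1) := ht
        linarith) hmono.directed_le
  have hchart : ∀ x : Q × I, ∃ e : OpenPartialHomeomorph X E,
      (∀ t : I, |(t : ℝ) - x.2| ≤ 1 / (n + 1) → η (x.1, t) ∈ e.source) ∧
      ∀ z ∈ V, ∀ a ∈ S, ∀ b ∈ S, z ∈ e.source → a ∈ e.source → b ∈ e.source →
        e z + (e b - e a) ∈ e.target → e.symm (e z + (e b - e a)) ∈ V :=
    fun x => (interior_subset : G n ⊆ _) (hn (Set.mem_univ x))
  set D : Set (Q × I) := {x : Q × I | x.2 = 0 ∨ ∀ t, η (x.1, t) = η (x.1, 0)} with hD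
  have hn0 : (0 : ℝ) < n + 1 := by positivity
  let P01 : ℝ → I := Set.projIcc (0 : ℝ) 1 zero_le_one
  have hP : Continuous P01 := continuous_projIcc
  have main : ∀ i : ℕ, IsMovable V D (fun x => η (x.1, 0))
      (fun x => η (x.1, min x.2 (P01 (i / (n + 1))))) := by
    intro i
    induction i with
    | zero =>
      have : ∀ x : Q × I, min x.2 (P01 ((0 : ℕ) / (n + 1))) = 0 := fun x => by
        have h0 : P01 ((0 : ℕ) / (n + 1)) = 0 := by
          simp [P01]
        rw [h0, min_eq_right unitInterval.nonneg']
      simp only [this]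
      exact IsMovable.refl _
    | succ i ih =>
      let ζ : C((Q × I) × I, X) :=
        ⟨fun y => η (y.1.1, min y.1.2 (P01 ((i + y.2) / (n + 1)))), by fun_prop⟩
      have hζ := isMovable_of_small (E := E) (V := V) (D := D) ζ (S := S) (fun _ => hη _) (fun x => ?_)
        (fun x hx t => ?_)
      · have e0 : (fun x => ζ (x, 0)) = fun x : Q × I => η (x.1, min x.2 (P01 (i / (n + 1)))) := by
          ext x
          simp [ζ]
        have e1 : (fun x => ζ (x, 1)) =
            fun x : Q × I => η (x.1, min x.2 (P01 ((i + 1 : ℕ) / (n + 1)))) := by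
          ext x
          simp [ζ]
        rw [e0, e1] at hζ
        exact ih.trans hζ
      · obtain ⟨e, he, he'⟩ := hchart (x.1, min x.2 (P01 (i / (n + 1))))
        refine ⟨e, fun t => he _ ?_, he'⟩
        have h1 : |(P01 ((i + t) / (n + 1)) : ℝ) - P01 (i / (n + 1))| ≤ 1 / (n + 1) := by
          refine (Set.abs_projIcc_sub_projIcc (zero_le_one (α := ℝ))).trans ?_
          rw [← sub_div, add_sub_cancel_left, abs_of_nonneg (div_nonneg t.2.1 hn0.le)]
          gcongr
          exact t.2.2
        refine le_trans ?_ h1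
        have := abs_min_sub_min_le_max (x.2 : ℝ) (P01 ((i + t) / (n + 1)) : ℝ) x.2 (P01 (i / (n + 1)))
        rw [sub_self, abs_zero, max_eq_right (abs_nonneg _)] at this
        exact this
      · rcases hx with h | h
        · simp [ζ, h]
        · change η (x.1, _) = η (x.1, _)
          rw [h, ← h]
  have h1 : (fun x : Q × I => η (x.1, min x.2 (P01 ((n + 1 : ℕ) / (n + 1))))) = η := by
    ext x
    have : P01 ((n + 1 : ℕ) / (n + 1)) = 1 := by
      rw [Nat.cast_add, Nat.cast_one, div_self hn0.ne']
      exact Set.projIcc_right (zero_le_one (α := ℝ))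
    rw [this, min_eq_left unitInterval.le_one']
  simpa only [h1] using main (n + 1)

/-- The initial point of an exit path. -/
def exitPaths.initial (S V : Set X) : C(exitPaths S V, S) where
  toFun γ := ⟨γ.1 0, γ.2.1⟩
  continuous_toFun := by fun_prop

/-- Translation charts make the initial point of exit paths a fibration: the initial parts of the
paths are moved along with their initial points. -/
theorem isRegularFibration_initial [T2Space X] {S : Set X} (hSV : HasTranslationCharts E S V) :
    IsRegularFibration (exitPaths.initial S V) := by
  intro P _ _ _ x h h0
  obtain ⟨O, F, hO, hmO, hF, hF1, hF2, hF3⟩ := isMovable_of_paths hSV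
    (⟨fun z => (h z : X), by fun_prop⟩ : C(P × I, X)) (fun z => (h z).2)
  simp only [ContinuousMap.coe_mk] at hmO hF1 hF3
  have hh0 : ∀ p, (h (p, 0) : X) = (x p).1 0 := fun p => congrArg Subtype.val (h0 p)
  obtain ⟨U, U', hU, -, hU0, hU', hUU⟩ := generalized_tube_lemma (isCompact_singleton (x := (0 : I)))
    (isCompact_univ (X := P × I))
    (hO.preimage (by fun_prop : Continuous fun y : I × (P × I) => (y.2, (x y.2.1).1 y.1))) (by
      rintro ⟨t, q⟩ ⟨ht, -⟩
      obtain rfl : t = 0 := ht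
      simpa [hh0] using hmO q)
  obtain ⟨a, ha, haU⟩ := exists_Ico_subset_of_mem_nhds (hU.mem_nhds (hU0 rfl)) ⟨1, zero_lt_one⟩
  obtain ⟨δ, hδ, hδa⟩ := exists_between ha
  have hδO : ∀ (q : P × I) (u : I), u ≤ δ → (q, (x q.1).1 u) ∈ O := fun q u hu =>
    @hUU (u, q) ⟨haU ⟨unitInterval.nonneg', hu.trans_lt hδa⟩, hU' (Set.mem_univ q)⟩
  have hδ0 : (0 : ℝ) < δ := hδ
  -- The move ends at the time `t * s u`.
  let s : I → I := fun u => Set.projIcc (0 : ℝ) 1 zero_le_one (1 - u / δ)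
  have hs : Continuous s := continuous_projIcc.comp (by fun_prop)
  have hs0 : s 0 = 1 := by simp [s]
  have hsδ : s δ = 0 := by
    simp [s, div_self hδ0.ne']
  let f : (P × I) × I → X := fun y => F ((y.1.1, y.1.2 * s y.2), (x y.1.1).1 y.2)
  let K : (P × I) × I → X := fun y => if y.2 ≤ δ then f y else (x y.1.1).1 y.2
  have hfδ : ∀ q : P × I, f (q, δ) = (x q.1).1 δ := fun q =>
    hF3 (q.1, q.2 * s δ) (Or.inl (by simp [hsδ])) _
  have hK : Continuous K := by
    refine continuous_if_le continuous_snd continuous_const ?_ (by fun_prop) ?_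
    · exact hF.comp (by fun_prop) fun y hy => hδO _ _ hy
    · rintro ⟨q, u⟩ (rfl : u = δ)
      exact hfδ q
  have hK0 : ∀ q, K (q, 0) = h q := fun q => by
    have : K (q, 0) = F (q, (x q.1).1 0) := by
      simp [K, f, hs0]
    rw [this, ← hh0]
    exact hF1 q
  have hKV : ∀ q u, 0 < u → K (q, u) ∈ V := fun q u hu => by
    by_cases huδ : u ≤ δ
    · simp only [K, huδ, if_true]
      exact hF2 _ _ (hδO _ _ huδ) ((x q.1).2.2 u hu)
    · simp only [K, huδ, if_false]
      exact (x q.1).2.2 u hu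
  have hKx : ∀ q : P × I, (q.2 = 0 ∨ ∀ t, (h (q.1, t) : X) = h (q.1, 0)) →
      ∀ u, K (q, u) = (x q.1).1 u := fun q hq u => by
    by_cases huδ : u ≤ δ
    · simp only [K, huδ, if_true]
      refine hF3 (q.1, q.2 * s u) ?_ _
      rcases hq with hq | hq
      · exact Or.inl (by simp [hq])
      · exact Or.inr hq
    · simp only [K, huδ, if_false]
  refine ⟨⟨fun q => ⟨ContinuousMap.curry ⟨K, hK⟩ q,
      (congrArg (· ∈ S) (hK0 q)).mpr (h q).2, hKV q⟩,
    Continuous.subtype_mk (ContinuousMap.continuous _) _⟩, fun p => ?_, fun q => ?_, fun p hp t => ?_⟩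
  · exact Subtype.ext (ContinuousMap.ext fun u => hKx (p, 0) (Or.inl rfl) u)
  · exact Subtype.ext (hK0 q)
  · refine Subtype.ext (ContinuousMap.ext fun u => hKx (p, t) (Or.inr fun t => ?_) u)
    rw [hp t, hp 0]

end Translation

/-! ### Linear charts around fixed points -/

section LinearChart

variable {Γ : Type*} [Group Γ] [Finite Γ] {m : ℕ} {X : Type*} [TopologicalSpace X]
  [ChartedSpace (EuclideanSpace ℝ (Fin m)) X] [MulAction Γ X]

/-- A smooth action of a finite group is linear in a suitable chart around a fixed point. -/
theorem exists_linear_chart (smooth : ∀ g : Γ, ContMDiff (𝓡 m) (𝓡 m) ∞ (fun x : X => g • x))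
    (x : X) (hx : ∀ g : Γ, g • x = x) :
    ∃ (e : OpenPartialHomeomorph X (EuclideanSpace ℝ (Fin m)))
      (L : Γ → EuclideanSpace ℝ (Fin m) →L[ℝ] EuclideanSpace ℝ (Fin m)),
      x ∈ e.source ∧ ∀ g, ∀ z ∈ e.source, g • z ∈ e.source ∧ e (g • z) = L g (e z) := by
  have := Fintype.ofFinite Γ
  let φ := chartAt (EuclideanSpace ℝ (Fin m)) x
  have hxφ : x ∈ φ.source := mem_chart_source _ x
  let x₀ := φ x
  let F : Γ → EuclideanSpace ℝ (Fin m) → EuclideanSpace ℝ (Fin m) := fun g y => φ (g • φ.symm y)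
  have hFx : ∀ g, F g x₀ = x₀ := fun g => by simp [F, x₀, φ.left_inv hxφ, hx]
  have hF : ∀ g, ContDiffAt ℝ ∞ (F g) x₀ := fun g => by
    have h := (contMDiffAt_iff.1 ((smooth g) x)).2
    simp only [hx g] at h
    rw [← contDiffWithinAt_univ]
    simpa [mfld_simps, F, x₀, φ, Function.comp_def] using h
  let L : Γ → EuclideanSpace ℝ (Fin m) →L[ℝ] EuclideanSpace ℝ (Fin m) := fun g => fderiv ℝ (F g) x₀
  have hL : ∀ g, HasStrictFDerivAt (F g) (L g) x₀ := fun g =>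
    (hF g).hasStrictFDerivAt (by simp)
  have hcont : ∀ g : Γ, Continuous fun z : X => g • z := fun g => (smooth g).continuous
  have hLmul : ∀ g k, L (g * k) = (L g).comp (L k) := fun g k => by
    have h1 : HasFDerivAt (F g ∘ F k) ((L g).comp (L k)) x₀ :=
      HasFDerivAt.comp x₀ (by rw [hFx k]; exact (hL g).hasFDerivAt) (hL k).hasFDerivAt
    have hev : F (g * k) =ᶠ[𝓝 x₀] F g ∘ F k := by
      have hs : ContinuousAt (fun y => k • φ.symm y) x₀ :=
        (hcont k).continuousAt.comp (φ.continuousAt_symm (φ.map_source hxφ))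
      have : ∀ᶠ y in 𝓝 x₀, k • φ.symm y ∈ φ.source := by
        refine hs.eventually_mem (φ.open_source.mem_nhds ?_)
        simpa [x₀, φ.left_inv hxφ, hx k] using hxφ
      filter_upwards [this] with y hy
      simp [F, φ.left_inv hy, mul_smul]
    exact ((hL (g * k)).hasFDerivAt.congr_of_eventuallyEq hev.symm).unique h1
  have hLone : L 1 = ContinuousLinearMap.id ℝ _ := by
    have hev : F 1 =ᶠ[𝓝 x₀] id := by
      filter_upwards [φ.open_target.mem_nhds (φ.map_source hxφ)] with y hy
      simp [F, φ.right_inv hy]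
    exact ((hL 1).hasFDerivAt.congr_of_eventuallyEq hev.symm).unique (hasFDerivAt_id x₀)
  -- The average of the chart over the group.
  let ψ : EuclideanSpace ℝ (Fin m) → EuclideanSpace ℝ (Fin m) :=
    fun y => (Fintype.card Γ : ℝ)⁻¹ • ∑ g, L g⁻¹ (F g y - x₀)
  have hψ : HasStrictFDerivAt ψ
      ((ContinuousLinearEquiv.refl ℝ (EuclideanSpace ℝ (Fin m)) :
        EuclideanSpace ℝ (Fin m) ≃L[ℝ] EuclideanSpace ℝ (Fin m)) :
        EuclideanSpace ℝ (Fin m) →L[ℝ] EuclideanSpace ℝ (Fin m)) x₀ := by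
    have h1 : HasStrictFDerivAt ψ ((Fintype.card Γ : ℝ)⁻¹ • ∑ g, (L g⁻¹).comp (L g)) x₀ := by
      refine HasStrictFDerivAt.fun_const_smul (HasStrictFDerivAt.fun_sum fun g _ => ?_) _
      exact (L g⁻¹).hasStrictFDerivAt.comp x₀ ((hL g).sub_const x₀)
    convert! h1 using 1
    simp only [← hLmul, inv_mul_cancel, hLone, Finset.sum_const, Finset.card_univ]
    rw [← Nat.cast_smul_eq_nsmul ℝ, smul_smul, inv_mul_cancel₀, one_smul]
    · rfl
    · exact_mod_cast Fintype.card_ne_zero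
  let e₀ := φ.trans (hψ.toOpenPartialHomeomorph ψ)
  have hxe : x ∈ e₀.source := by
    simp only [e₀, OpenPartialHomeomorph.trans_source]
    exact ⟨hxφ, hψ.mem_toOpenPartialHomeomorph_source⟩
  have he₀ : ∀ z, e₀ z = ψ (φ z) := fun z => rfl
  have hsub : ∀ z ∈ e₀.source, z ∈ φ.source := fun z hz => by
    simp only [e₀, OpenPartialHomeomorph.trans_source] at hz
    exact hz.1
  let U : Set X := ⋂ g : Γ, (fun z => g • z) ⁻¹' e₀.source
  have hU : IsOpen U := isOpen_iInter_of_finite fun g => e₀.open_source.preimage (hcont g)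
  have hUe : ∀ z ∈ U, z ∈ e₀.source := fun z hz => by simpa using Set.mem_iInter.1 hz 1
  refine ⟨e₀.restrOpen U hU, L, ⟨hxe, Set.mem_iInter.2 fun g => by simpa [hx g] using hxe⟩, ?_⟩
  rintro g z ⟨-, hz⟩
  have hgz : g • z ∈ U := Set.mem_iInter.2 fun k => by
    simpa [mul_smul] using Set.mem_iInter.1 hz (k * g)
  refine ⟨⟨hUe _ hgz, hgz⟩, ?_⟩
  change e₀ (g • z) = L g (e₀ z)
  have hψφ : ∀ z ∈ U, ψ (φ z) = (Fintype.card Γ : ℝ)⁻¹ • ∑ g : Γ, L g⁻¹ (φ (g • z) - x₀) := by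
    intro z hz
    simp [ψ, F, φ.left_inv (hsub z (hUe z hz))]
  rw [he₀, he₀, hψφ _ hgz, hψφ _ hz, map_smul, map_sum]
  congr 1
  refine Fintype.sum_equiv (Equiv.mulRight g) _ _ fun k => ?_
  rw [← ContinuousLinearMap.comp_apply, ← hLmul]
  simp [mul_smul]

end LinearChart

/-! ### The local structure of the strata -/

section Strata

variable {G : Type*} [Group G] [Finite G] {X : Type*} [TopologicalSpace X] [MulAction G X]

/-- `K` is minimal among the isotropy groups which are strictly larger than `H`. -/
def IsMinimalOver (X : Type*) [MulAction G X] (H K : Subgroup G) : Prop :=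
  Minimal (fun K => IsIsotropyGroup G X K ∧ H < K) K

omit [Finite G] [TopologicalSpace X] in
theorem mem_fixedPoints_iff_le_stabilizer {H : Subgroup G} {x : X} :
    x ∈ MulAction.fixedPoints H X ↔ H ≤ MulAction.stabilizer G x := by
  simp [MulAction.mem_fixedPoints, SetLike.le_def, Subgroup.smul_def]

omit [Finite G] in
theorem isClosed_fixedPoints_subgroup [T2Space X] (hc : ∀ g : G, Continuous fun x : X => g • x)
    (H : Subgroup G) : IsClosed (MulAction.fixedPoints H X) := by
  have : MulAction.fixedPoints H X = ⋂ h : H, {x | (h : G) • x = x} := by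
    ext x
    simp [MulAction.mem_fixedPoints, Subgroup.smul_def]
  rw [this]
  exact isClosed_iInter fun h => isClosed_eq (hc h) continuous_id

/-- If the isotropy structure is treelike and `K` is minimal over `H`, then `X^K` is a union of
components of the singular set of `X^H`: the points of the singular set outside of `X^K` form a
closed set. -/
theorem IsMinimalOver.exists_isClosed [T2Space X] (hc : ∀ g : G, Continuous fun x : X => g • x)
    (ht : HasTreelikeIsotropy G X) {H K : Subgroup G} (hK : IsMinimalOver X H K) :
    ∃ C : Set X, IsClosed C ∧ Disjoint (MulAction.fixedPoints K X) C ∧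
      ∀ x, H < MulAction.stabilizer G x → x ∈ MulAction.fixedPoints K X ∨ x ∈ C := by
  have : Finite (Subgroup G) := inferInstance
  refine ⟨⋃ K' ∈ {K' : Subgroup G | IsIsotropyGroup G X K' ∧ H < K' ∧ ¬ K ≤ K'},
    MulAction.fixedPoints K' X, ?_, ?_, fun x hx => ?_⟩
  · exact (Set.toFinite _).isClosed_biUnion fun K' _ => isClosed_fixedPoints_subgroup hc K'
  · rw [Set.disjoint_left]
    intro x hxK hx
    simp only [Set.mem_iUnion] at hx
    obtain ⟨K', ⟨hK', hHK', hKK'⟩, hxK'⟩ := hx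
    rw [mem_fixedPoints_iff_le_stabilizer] at hxK hxK'
    rcases (ht _ ⟨x, rfl⟩).2.total ⟨hK.1.1, hxK⟩ ⟨hK', hxK'⟩ with h | h
    · exact hKK' h
    · exact hKK' (hK.2 ⟨hK', hHK'⟩ h)
  · by_cases hKx : K ≤ MulAction.stabilizer G x
    · exact Or.inl (mem_fixedPoints_iff_le_stabilizer.2 hKx)
    · refine Or.inr (Set.mem_biUnion (x := MulAction.stabilizer G x) ⟨⟨x, rfl⟩, hx, hKx⟩ ?_)
      exact mem_fixedPoints_iff_le_stabilizer.2 le_rfl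

/-- In a chart around a point of `X^K` in which `K` acts linearly, the translations along `X^K`
preserve `X_H`. -/
theorem IsMinimalOver.hasTranslationCharts [T2Space X] {m : ℕ}
    [ChartedSpace (EuclideanSpace ℝ (Fin m)) X] [IsManifold (𝓡 m) ∞ X]
    (smooth : ∀ g : G, ContMDiff (𝓡 m) (𝓡 m) ∞ (fun x : X => g • x))
    (ht : HasTreelikeIsotropy G X) {H K : Subgroup G} (hK : IsMinimalOver X H K) :
    HasTranslationCharts (EuclideanSpace ℝ (Fin m)) (MulAction.fixedPoints K X) (stratum X H) := by
  intro x hx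
  obtain ⟨C, hC, hKC, hHC⟩ := hK.exists_isClosed (fun g => (smooth g).continuous) ht
  obtain ⟨e, L, hxe, he⟩ := exists_linear_chart (Γ := K) (fun g => smooth g) x hx
  refine ⟨e.restrOpen Cᶜ hC.isOpen_compl, ⟨hxe, Set.disjoint_left.1 hKC hx⟩, ?_⟩
  rintro z hz a ha b hb ⟨hze, -⟩ ⟨hae, -⟩ ⟨hbe, -⟩ hw
  set w := e z + (e b - e a) with hw_def
  have hw' : w ∈ e.target := hw.1
  have hy : e.symm w ∈ e.source := e.map_target hw'
  have hyC : e.symm w ∉ C := hw.2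
  change MulAction.stabilizer G (e.symm w) = H
  have hfix : ∀ (k : K) (y : X), y ∈ e.source → (L k (e y) = e y ↔ k • y = y) := fun k y hy => by
    rw [← (he k y hy).2]
    exact ⟨fun h => e.injOn (he k y hy).1 hy h, fun h => by rw [h]⟩
  have hwfix : ∀ k : K, L k w = w ↔ k • z = z := fun k => by
    have h1 : L k (e b) = e b := (hfix k b hbe).2 (hb k)
    have h2 : L k (e a) = e a := (hfix k a hae).2 (ha k)
    rw [← hfix k z hze, hw_def, map_add, map_sub, h1, h2, add_left_inj]
  have hyz : ∀ k : K, k • e.symm w = e.symm w ↔ k • z = z := fun k => by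
    rw [← hwfix, ← hfix k _ hy, e.right_inv hw']
  have hz' : MulAction.stabilizer G z = H := hz
  have hle : H ≤ MulAction.stabilizer G (e.symm w) := fun h hh => by
    refine (hyz ⟨h, hK.1.2.le hh⟩).2 ?_
    rw [← hz'] at hh
    exact hh
  refine (hle.eq_or_lt.resolve_right fun hlt => ?_).symm
  have hyK := (hHC _ hlt).resolve_right hyC
  have : K ≤ MulAction.stabilizer G z :=
    mem_fixedPoints_iff_le_stabilizer.1 fun k => (hyz k).1 (hyK k)
  exact (hK.1.2.trans_le this).ne hz'.symm

end Strata

/-! ### Homotopies as maps out of cylinders, and retracts -/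

section Cylinder

variable {X Y : Type*} [TopologicalSpace X] [TopologicalSpace Y]

theorem HasHELP.exists_cylinder {f : C(X, Y)} (hf : HasHELP f) {P : Type} [TopologicalSpace P]
    [CompactSpace P] [T2Space P] {A : Set P} (hA : IsCofib A) (α : C(A, X)) (b : C(P, Y))
    (hb : ∀ p : A, b p = f (α p)) :
    ∃ (a : C(P, X)) (c : C(P × I, Y)), (∀ p : A, a p = α p) ∧ (∀ p, c (p, 0) = f (a p)) ∧
      (∀ p, c (p, 1) = b p) ∧ ∀ p ∈ A, ∀ t, c (p, t) = b p := by
  obtain ⟨a, ha, ⟨F⟩⟩ := hf P A hA α b hb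
  refine ⟨a, ⟨fun z => F (z.2, z.1), by fun_prop⟩, ha, fun p => F.apply_zero p,
    fun p => F.apply_one p, fun p hp t => ?_⟩
  have h1 : F (t, p) = f (a p) := F.eq_fst t hp
  have h2 : b p = f (a p) := by rw [hb ⟨p, hp⟩, ← ha ⟨p, hp⟩]
  exact h1.trans h2.symm

theorem HasHELP.of_cylinder {f : C(X, Y)}
    (h : ∀ (P : Type) [TopologicalSpace P] [CompactSpace P] [T2Space P] (A : Set P), IsCofib A →
      ∀ (α : C(A, X)) (b : C(P, Y)), (∀ p : A, b p = f (α p)) →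
        ∃ (a : C(P, X)) (c : C(P × I, Y)), (∀ p : A, a p = α p) ∧ (∀ p, c (p, 0) = f (a p)) ∧
          (∀ p, c (p, 1) = b p) ∧ ∀ p ∈ A, ∀ t, c (p, t) = b p) : HasHELP f := by
  intro P _ _ _ A hA α b hb
  obtain ⟨a, c, ha, h0, h1, hc⟩ := h P A hA α b hb
  refine ⟨a, ha, ⟨⟨⟨⟨fun z => c (z.2, z.1), by fun_prop⟩, h0, h1⟩, fun t p hp => ?_⟩⟩⟩
  have : f (a p) = b p := by rw [hb ⟨p, hp⟩, ← ha ⟨p, hp⟩]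
  exact (hc p hp t).trans this.symm

/-- The homotopy extension and lifting property passes to retracts; it is enough that the
retractions are continuous on compact Hausdorff spaces of parameters. -/
theorem HasHELP.of_retract {X' Y' : Type*} [TopologicalSpace X'] [TopologicalSpace Y']
    {f : C(X, Y)} {f' : C(X', Y')} (hf : HasHELP f) (iX : C(X', X)) (iY : C(Y', Y))
    (rX : X → X') (rY : Y → Y')
    (hrX : ∀ (P : Type) [TopologicalSpace P] [CompactSpace P] [T2Space P] (u : C(P, X)),
      Continuous fun p => rX (u p))
    (hrY : ∀ (P : Type) [TopologicalSpace P] [CompactSpace P] [T2Space P] (u : C(P, Y)),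
      Continuous fun p => rY (u p))
    (hi : ∀ x, f (iX x) = iY (f' x)) (hr : ∀ x, f' (rX x) = rY (f x))
    (hX : ∀ x, rX (iX x) = x) (hY : ∀ y, rY (iY y) = y) : HasHELP f' := by
  refine HasHELP.of_cylinder fun P _ _ _ A hA α b hb => ?_
  obtain ⟨a, c, ha, h0, h1, hc⟩ := hf.exists_cylinder hA (iX.comp α) (iY.comp b)
    (fun p => by simp [hb, hi])
  refine ⟨⟨_, hrX P a⟩, ⟨_, hrY (P × I) c⟩, fun p => ?_, fun p => ?_, fun p => ?_, fun p hp t => ?_⟩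
  · simp [ha, hX]
  · simp [h0, hr]
  · simp [h1, hY]
  · simp [hc p hp, hY]

end Cylinder

/-! ### Exit paths between strata -/

section ExitPathsStrata

variable {G : Type*} [Group G] {X Y : Type*} [TopologicalSpace X] [TopologicalSpace Y]
  [MulAction G X] [MulAction G Y] (f : IsovariantMap G X Y)

theorem IsovariantMap.mem_fixedPoints_iff {H : Subgroup G} {x : X} :
    f.toContinuousMap x ∈ MulAction.fixedPoints H Y ↔ x ∈ MulAction.fixedPoints H X := by
  rw [mem_fixedPoints_iff_le_stabilizer, mem_fixedPoints_iff_le_stabilizer, f.stabilizer_map]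

theorem IsovariantMap.mem_singularSet_iff {H : Subgroup G} {x : MulAction.fixedPoints H X} :
    f.onFixedPoints H x ∈ singularSet Y H ↔ x ∈ singularSet X H := by
  change H < MulAction.stabilizer G (f.toContinuousMap x) ↔ _
  rw [f.stabilizer_map]
  rfl

theorem IsovariantMap.DulaSchultzConditions.isIsotropyGroup_iff {f : IsovariantMap G X Y}
    (hf : f.DulaSchultzConditions) {H : Subgroup G} :
    IsIsotropyGroup G Y H ↔ IsIsotropyGroup G X H := by
  refine ⟨fun h => ?_, fun ⟨x, hx⟩ => ⟨f.toContinuousMap x, (f.stabilizer_map x).trans hx⟩⟩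
  obtain ⟨e, -⟩ := hf.stratum H (Or.inr h)
  obtain ⟨y, hy⟩ := h
  exact ⟨_, (e.invFun ⟨y, hy⟩).2⟩

theorem IsovariantMap.DulaSchultzConditions.isMinimalOver_iff {f : IsovariantMap G X Y}
    (hf : f.DulaSchultzConditions) {H K : Subgroup G} :
    IsMinimalOver Y H K ↔ IsMinimalOver X H K := by
  simp only [IsMinimalOver, hf.isIsotropyGroup_iff]

/-- The map which an isovariant map induces on spaces of exit paths from `X^K` to `X_H`. -/
def IsovariantMap.onExitPaths (f : IsovariantMap G X Y) (H K : Subgroup G) :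
    C(exitPaths (MulAction.fixedPoints K X) (stratum X H),
      exitPaths (MulAction.fixedPoints K Y) (stratum Y H)) :=
  exitPaths.map f.toContinuousMap (fun _ hz => f.mem_fixedPoints_iff.2 hz)
    fun z hz => (f.stabilizer_map z).trans hz

/-- An exit path from `X^K` to `X_H` as a path in `X^H`, starting in the singular set. -/
def toSingularExitPaths (X : Type*) [TopologicalSpace X] [MulAction G X] {H K : Subgroup G}
    (hHK : H < K) : C(exitPaths (MulAction.fixedPoints K X) (stratum X H),
      exitPaths (singularSet X H) (singularSet X H)ᶜ) where
  toFun γ := ⟨⟨fun u => ⟨γ.1 u, mem_fixedPoints_iff_le_stabilizer.2 (by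
      rcases eq_or_lt_of_le (unitInterval.nonneg' (t := u)) with h | h
      · rw [← h]
        exact hHK.le.trans (mem_fixedPoints_iff_le_stabilizer.1 γ.2.1)
      · exact (γ.2.2 u h).ge)⟩, by fun_prop⟩,
    hHK.trans_le (mem_fixedPoints_iff_le_stabilizer.1 γ.2.1), fun u hu h => h.ne' (γ.2.2 u hu)⟩
  continuous_toFun := by
    refine Continuous.subtype_mk (ContinuousMap.continuous_of_continuous_uncurry _ ?_) _
    refine Continuous.subtype_mk ?_ _
    exact (by fun_prop : Continuous fun x : exitPaths (MulAction.fixedPoints K X) (stratum X H) × I =>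
      x.1.1 x.2)

theorem mem_stratum_of_exitPaths {H : Subgroup G}
    (γ : exitPaths (singularSet X H) (singularSet X H)ᶜ) (u : I) (hu : 0 < u) :
    ((γ.1 u : MulAction.fixedPoints H X) : X) ∈ stratum X H :=
  ((mem_fixedPoints_iff_le_stabilizer.1 (γ.1 u).2).eq_or_lt.resolve_right (γ.2.2 u hu)).symm

variable [Finite G] [T2Space X] [CompactSpace X] [T2Space Y] [CompactSpace Y]

omit [CompactSpace X] in
theorem isClosed_singularSet (hc : ∀ g : G, Continuous fun x : X => g • x) (H : Subgroup G) :
    IsClosed (singularSet X H) := by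
  have : singularSet X H = ⋃ K ∈ {K : Subgroup G | H < K},
      (Subtype.val ⁻¹' MulAction.fixedPoints K X) := by
    ext x
    simp only [Set.mem_iUnion, Set.mem_preimage, mem_fixedPoints_iff_le_stabilizer]
    exact ⟨fun h => ⟨_, h, le_rfl⟩, fun ⟨K, hK, h⟩ => lt_of_lt_of_le hK h⟩
  rw [this]
  exact (Set.toFinite _).isClosed_biUnion fun K _ =>
    (isClosed_fixedPoints_subgroup hc K).preimage continuous_subtype_val

/-- Among the exit paths in `X^H` from the singular set, those which start in `X^K` form a union of
path components, since `X^K` is open and closed in the singular set. -/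
theorem IsovariantMap.DulaSchultzConditions.hasHELP_onExitPaths
    (hcX : ∀ g : G, Continuous fun x : X => g • x) (hcY : ∀ g : G, Continuous fun y : Y => g • y)
    (htY : HasTreelikeIsotropy G Y) {f : IsovariantMap G X Y} (hf : f.DulaSchultzConditions)
    {H K : Subgroup G} (hH : IsIsotropyGroup G X H) (hK : IsMinimalOver Y H K) :
    HasHELP (f.onExitPaths H K) := by
  obtain ⟨N, M, g, hg, he⟩ := hf.boundary H (Or.inl hH)
  have := isCompact_iff_compactSpace.1 (isClosed_fixedPoints_subgroup hcX H).isCompact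
  have := isCompact_iff_compactSpace.1 (isClosed_fixedPoints_subgroup hcY H).isCompact
  have hHELP := N.hasHELP_exitPaths (isClosed_singularSet hcX H) (isClosed_singularSet hcY H) M
    (f.onFixedPoints H) (fun z => f.mem_singularSet_iff.2) (fun z => mt f.mem_singularSet_iff.1)
    hg he
  obtain ⟨C, hC, hKC, hHC⟩ := hK.exists_isClosed hcY htY
  have hHK := hK.1.2
  refine HasHELP.of_cylinder fun P _ _ _ A hA α b hb => ?_
  obtain ⟨a, c, ha, h0, h1, hcA⟩ := hHELP.exists_cylinder hA ((toSingularExitPaths X hHK).comp α)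
    ((toSingularExitPaths Y hHK).comp b) (fun p => by
      refine Subtype.ext (ContinuousMap.ext fun u => Subtype.ext ?_)
      change (b p).1 u = f.toContinuousMap ((α p).1 u)
      rw [hb]
      rfl)
  -- The initial point of `c (p, t)` stays in `Y^K`, which is open and closed in the singular set.
  have hstart : ∀ p t, ((c (p, t)).1 0 : Y) ∈ MulAction.fixedPoints K Y := by
    intro p
    let D : Set I := {t | ((c (p, t)).1 0 : Y) ∈ MulAction.fixedPoints K Y}
    have hcont : Continuous fun t => ((c (p, t)).1 0 : Y) := by fun_prop
    have hD : IsClopen D := by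
      refine ⟨(isClosed_fixedPoints_subgroup hcY K).preimage hcont, ?_⟩
      have : D = {t | ((c (p, t)).1 0 : Y) ∈ C}ᶜ := by
        ext t
        exact ⟨fun h h' => Set.disjoint_left.1 hKC h h',
          fun h => (hHC _ (c (p, t)).2.1).resolve_right h⟩
      rw [this]
      exact (hC.preimage hcont).isOpen_compl
    have h1' : (1 : I) ∈ D := by
      change ((c (p, 1)).1 0 : Y) ∈ MulAction.fixedPoints K Y
      rw [h1]
      exact (b p).2.1
    have := hD.eq_univ ⟨1, h1'⟩
    exact fun t => this.ge (Set.mem_univ t)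
  let vX : C(MulAction.fixedPoints H X, X) := ⟨Subtype.val, continuous_subtype_val⟩
  let vY : C(MulAction.fixedPoints H Y, Y) := ⟨Subtype.val, continuous_subtype_val⟩
  refine ⟨⟨fun p => ⟨vX.comp (a p).1, ?_, mem_stratum_of_exitPaths (a p)⟩, Continuous.subtype_mk
      ((ContinuousMap.continuous_postcomp vX).comp (by fun_prop)) _⟩,
    ⟨fun z => ⟨vY.comp (c z).1, hstart z.1 z.2, mem_stratum_of_exitPaths (c z)⟩, Continuous.subtype_mk
      ((ContinuousMap.continuous_postcomp vY).comp (by fun_prop)) _⟩,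
    fun p => ?_, fun p => ?_, fun p => ?_, fun p hp t => ?_⟩
  · have h := hstart p 0
    rw [h0] at h
    exact f.mem_fixedPoints_iff.1 h
  · exact Subtype.ext (congrArg (fun γ => vX.comp γ.1) (ha p))
  · exact Subtype.ext (congrArg (fun γ => vY.comp γ.1) (h0 p))
  · exact Subtype.ext (congrArg (fun γ => vY.comp γ.1) (h1 p))
  · exact Subtype.ext (congrArg (fun γ => vY.comp γ.1) (hcA p hp t))

end ExitPathsStrata

/-! ### Maps from cubes with prescribed isotropy groups -/

section CubeMaps

variable {G : Type*} [Group G]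

/-- The stratification of the cube by a chain of subgroups: the value at `v` is `H k` for the first
`k` with `v k ≠ 0`, and the last subgroup of the chain at `v = 0`. -/
noncomputable def cubeStabilizer : (n : ℕ) → (Fin (n + 1) → Subgroup G) → (Fin n → I) → Subgroup G
  | 0, H, _ => H 0
  | n + 1, H, v =>
    if v 0 = 0 then cubeStabilizer n (Fin.tail H) (Fin.tail v) else H 0

theorem cubeStabilizer_of_eq_zero {n : ℕ} {H : Fin (n + 2) → Subgroup G} {v : Fin (n + 1) → I}
    (h : v 0 = 0) : cubeStabilizer (n + 1) H v = cubeStabilizer n (Fin.tail H) (Fin.tail v) :=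
  if_pos h

theorem cubeStabilizer_of_ne_zero {n : ℕ} {H : Fin (n + 2) → Subgroup G} {v : Fin (n + 1) → I}
    (h : v 0 ≠ 0) : cubeStabilizer (n + 1) H v = H 0 :=
  if_neg h

theorem cubeStabilizer_congr : ∀ {n : ℕ} {H : Fin (n + 1) → Subgroup G} {v w : Fin n → I},
    (∀ k, v k = 0 ↔ w k = 0) → cubeStabilizer n H v = cubeStabilizer n H w
  | 0, _, _, _, _ => rfl
  | n + 1, H, v, w, h => by
    by_cases hv : v 0 = 0
    · rw [cubeStabilizer_of_eq_zero hv, cubeStabilizer_of_eq_zero ((h 0).1 hv)]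
      exact cubeStabilizer_congr fun k => h k.succ
    · rw [cubeStabilizer_of_ne_zero hv, cubeStabilizer_of_ne_zero (mt (h 0).2 hv)]

theorem mem_cubeStabilizer : ∀ {n : ℕ} {H : Fin (n + 1) → Subgroup G} (_ : Monotone H)
    {v : Fin n → I} {g : G}, g ∈ cubeStabilizer n H v ↔
      ∃ k, (∀ j : Fin n, j.castSucc < k → v j = 0) ∧ g ∈ H k
  | 0, H, _, v, g => by
    refine ⟨fun h => ⟨0, fun j => j.elim0, h⟩, fun ⟨k, _, h⟩ => ?_⟩
    rwa [Fin.fin_one_eq_zero k] at h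
  | n + 1, H, hH, v, g => by
    by_cases hv : v 0 = 0
    · rw [cubeStabilizer_of_eq_zero hv,
        mem_cubeStabilizer (H := Fin.tail H) (fun i j hij => hH (Fin.succ_le_succ_iff.2 hij))]
      constructor
      · rintro ⟨k, hk, hg⟩
        refine ⟨k.succ, fun j => ?_, hg⟩
        refine Fin.cases (fun _ => hv) (fun j hj => hk j ?_) j
        exact Fin.succ_lt_succ_iff.1 hj
      · rintro ⟨k, hk, hg⟩
        revert hk hg
        refine Fin.cases (fun _ hg => ⟨0, fun j hj => absurd hj (Fin.not_lt_zero _),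
          hH (Fin.zero_le _) hg⟩) (fun k hk hg => ⟨k, fun j hj => hk j.succ ?_, hg⟩) k
        exact Fin.succ_lt_succ_iff.2 hj
    · rw [cubeStabilizer_of_ne_zero hv]
      refine ⟨fun h => ⟨0, fun j hj => absurd hj (Fin.not_lt_zero _), h⟩, ?_⟩
      rintro ⟨k, hk, hg⟩
      rcases Fin.eq_zero_or_eq_succ k with rfl | ⟨k, rfl⟩
      · exact hg
      · exact absurd (hk 0 (Fin.succ_pos k)) hv

theorem le_cubeStabilizer {n : ℕ} {H : Fin (n + 1) → Subgroup G} (hH : Monotone H)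
    (v : Fin n → I) : H 0 ≤ cubeStabilizer n H v := fun _ hg =>
  (mem_cubeStabilizer hH).2 ⟨0, fun _ hj => absurd hj (Fin.not_lt_zero _), hg⟩

theorem exists_cubeStabilizer_eq : ∀ {n : ℕ} (H : Fin (n + 1) → Subgroup G) (k : Fin (n + 1)),
    ∃ v, cubeStabilizer n H v = H k
  | 0, H, k => ⟨fun _ => 0, by rw [Fin.fin_one_eq_zero k]; rfl⟩
  | n + 1, H, k => by
    rcases Fin.eq_zero_or_eq_succ k with rfl | ⟨k, rfl⟩
    · exact ⟨fun _ => 1, cubeStabilizer_of_ne_zero one_ne_zero⟩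
    · obtain ⟨v, hv⟩ := exists_cubeStabilizer_eq (Fin.tail H) k
      exact ⟨Fin.cons 0 v, (cubeStabilizer_of_eq_zero (Fin.cons_zero _ _)).trans
        ((congrArg _ (Fin.tail_cons _ _)).trans hv)⟩

variable {n : ℕ} {X Y : Type*} [TopologicalSpace X] [TopologicalSpace Y]
  [MulAction G X] [MulAction G Y]

/-- The maps from a cube to `X` with isotropy groups as prescribed by a chain of subgroups. -/
def cubeMaps (X : Type*) [TopologicalSpace X] [MulAction G X] (H : Fin (n + 1) → Subgroup G) :
    Set C(Fin n → I, X) :=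
  {γ | ∀ v, MulAction.stabilizer G (γ v) = cubeStabilizer n H v}

/-- Postcomposition with an isovariant map. -/
def IsovariantMap.onCubeMaps (f : IsovariantMap G X Y) (H : Fin (n + 1) → Subgroup G) :
    C(cubeMaps X H, cubeMaps Y H) where
  toFun γ := ⟨f.toContinuousMap.comp γ.1, fun v => (f.stabilizer_map _).trans (γ.2 v)⟩
  continuous_toFun := Continuous.subtype_mk
    ((ContinuousMap.continuous_postcomp _).comp continuous_subtype_val) _

/-- Restriction to the face `v 0 = 0`. -/
def cubeMaps.face (X : Type*) [TopologicalSpace X] [MulAction G X]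
    (H : Fin (n + 2) → Subgroup G) : C(cubeMaps X H, cubeMaps X (Fin.tail H)) where
  toFun γ := ⟨γ.1.comp ⟨fun v => Fin.cons (α := fun _ => I) 0 v, by fun_prop⟩, fun v => by
    refine (γ.2 _).trans ((cubeStabilizer_of_eq_zero (Fin.cons_zero _ _)).trans ?_)
    rw [Fin.tail_cons]⟩
  continuous_toFun := Continuous.subtype_mk
    ((ContinuousMap.continuous_precomp _).comp continuous_subtype_val) _

/-- Evaluation of maps from a cube all of whose isotropy groups contain `K`. -/
def cubeMaps.eval (X : Type*) [TopologicalSpace X] [MulAction G X] {H : Fin (n + 1) → Subgroup G}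
    (hH : Monotone H) {K : Subgroup G} (hK : K ≤ H 0) :
    C(cubeMaps X H × (Fin n → I), MulAction.fixedPoints K X) where
  toFun z := ⟨z.1.1 z.2, mem_fixedPoints_iff_le_stabilizer.2
    (hK.trans ((le_cubeStabilizer hH _).trans (z.1.2 z.2).ge))⟩
  continuous_toFun := Continuous.subtype_mk (by fun_prop) _

/-- The lines of a cube in the first coordinate direction, as exit paths. -/
def cubeMaps.lines (X : Type*) [TopologicalSpace X] [MulAction G X]
    {H : Fin (n + 2) → Subgroup G} (hH : Monotone H) {K : Subgroup G} (hK : K ≤ H 1) :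
    C(cubeMaps X H × (Fin n → I), exitPaths (MulAction.fixedPoints K X) (stratum X (H 0))) where
  toFun z := ⟨⟨fun u => z.1.1 (Fin.cons (α := fun _ => I) u z.2), by fun_prop⟩,
    (cubeMaps.eval X (H := Fin.tail H) (fun i j hij => hH (Fin.succ_le_succ_iff.2 hij)) hK
      (cubeMaps.face X H z.1, z.2)).2, fun u hu => (z.1.2 _).trans
        (cubeStabilizer_of_ne_zero hu.ne')⟩
  continuous_toFun := by
    refine Continuous.subtype_mk (ContinuousMap.continuous_of_continuous_uncurry _ ?_) _
    exact (by fun_prop : Continuous fun x : (cubeMaps X H × (Fin n → I)) × I =>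
      x.1.1.1 (Fin.cons (α := fun _ => I) x.2 x.1.2))

/-- Maps from a cube, assembled from exit paths which start on a given map from the face
`v 0 = 0`. -/
def cubeMaps.ofLines {T : Type*} [TopologicalSpace T] {H : Fin (n + 2) → Subgroup G}
    {K : Subgroup G}
    (l : C(T × (Fin n → I), exitPaths (MulAction.fixedPoints K X) (stratum X (H 0))))
    (s₀ : C(T, cubeMaps X (Fin.tail H)))
    (h : ∀ t v, (l (t, v)).1 0 = (s₀ t).1 v) : C(T, cubeMaps X H) where
  toFun t := ⟨⟨fun v => (l (t, Fin.tail v)).1 (v 0), by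
      have : Continuous fun v : Fin (n + 1) → I => (t, Fin.tail v) := by
        unfold Fin.tail
        fun_prop
      fun_prop⟩, fun v => by
    change MulAction.stabilizer G ((l (t, Fin.tail v)).1 (v 0)) = _
    by_cases hv : v 0 = 0
    · rw [cubeStabilizer_of_eq_zero hv, hv, h]
      exact (s₀ t).2 _
    · rw [cubeStabilizer_of_ne_zero hv]
      exact (l (t, Fin.tail v)).2.2 _ (unitInterval.pos_iff_ne_zero.2 hv)⟩
  continuous_toFun := by
    refine Continuous.subtype_mk (ContinuousMap.continuous_of_continuous_uncurry _ ?_) _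
    have : Continuous fun x : T × (Fin (n + 1) → I) => (x.1, Fin.tail x.2) := by
      unfold Fin.tail
      fun_prop
    exact (by fun_prop : Continuous fun x : T × (Fin (n + 1) → I) => (l (x.1, Fin.tail x.2)).1 (x.2 0))

end CubeMaps

/-! ### The homotopy extension and lifting property for maps from cubes -/

section Induction

variable {G : Type*} [Group G] [Finite G] {m n : ℕ}
  {X : Type*} [TopologicalSpace X] [ChartedSpace (EuclideanSpace ℝ (Fin m)) X]
  [IsManifold (𝓡 m) ∞ X] [T2Space X] [CompactSpace X] [MulAction G X]
  {Y : Type*} [TopologicalSpace Y] [ChartedSpace (EuclideanSpace ℝ (Fin n)) Y]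
  [IsManifold (𝓡 n) ∞ Y] [T2Space Y] [CompactSpace Y] [MulAction G Y]

theorem IsovariantMap.DulaSchultzConditions.hasHELP_onCubeMaps_of_isIsotropyGroup
    (smooth_X : ∀ g : G, ContMDiff (𝓡 m) (𝓡 m) ∞ (fun x : X => g • x))
    (smooth_Y : ∀ g : G, ContMDiff (𝓡 n) (𝓡 n) ∞ (fun y : Y => g • y))
    (treelike_X : HasTreelikeIsotropy G X) (treelike_Y : HasTreelikeIsotropy G Y)
    {f : IsovariantMap G X Y} (hf : f.DulaSchultzConditions) {d : ℕ}
    {H : Fin (d + 1) → Subgroup G} (hH : StrictMono H) (hiso : ∀ k, IsIsotropyGroup G X (H k)) :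
    HasHELP (f.onCubeMaps H) := by
  induction d with
  | zero =>
    -- A map from a cube of dimension `0` is a point of a stratum.
    have h0 := (IsMappingPathFull.of_isHomotopyEquiv (hf.stratum _ (Or.inl (hiso 0)))).hasHELP
    let iX : C(cubeMaps X H, _root_.stratum X (H 0)) := ⟨fun γ => ⟨γ.1 0, γ.2 0⟩, by fun_prop⟩
    let iY : C(cubeMaps Y H, _root_.stratum Y (H 0)) := ⟨fun γ => ⟨γ.1 0, γ.2 0⟩, by fun_prop⟩
    refine h0.of_retract iX iY (fun x => ⟨ContinuousMap.const _ x.1, fun _ => x.2⟩)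
      (fun x => ⟨ContinuousMap.const _ x.1, fun _ => x.2⟩) (fun P _ _ _ u => ?_)
      (fun P _ _ _ u => ?_) (fun _ => rfl) (fun _ => rfl) (fun γ => ?_) (fun γ => ?_)
    · exact Continuous.subtype_mk (ContinuousMap.const'.continuous.comp (by fun_prop)) _
    · exact Continuous.subtype_mk (ContinuousMap.const'.continuous.comp (by fun_prop)) _
    · exact Subtype.ext (ContinuousMap.ext fun v => congrArg γ.1 (Subsingleton.elim _ _))
    · exact Subtype.ext (ContinuousMap.ext fun v => congrArg γ.1 (Subsingleton.elim _ _))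
  | succ d ih =>
    have hT : StrictMono (Fin.tail H) := fun i j hij => hH (Fin.succ_lt_succ_iff.2 hij)
    obtain ⟨K, hK1, hK⟩ := exists_minimal_le_of_wellFoundedLT
      (fun K => IsIsotropyGroup G X K ∧ H 0 < K) (H 1) ⟨hiso 1, hH (by simp)⟩
    have hKX : IsMinimalOver X (H 0) K := hK
    have hKY : IsMinimalOver Y (H 0) K := hf.isMinimalOver_iff.2 hK
    have hfix := (IsMappingPathFull.of_isHomotopyEquiv
      (hf.fixedPoints K (Or.inl hK.1.1))).hasHELP
    have hexit := hf.hasHELP_onExitPaths (fun g => (smooth_X g).continuous)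
      (fun g => (smooth_Y g).continuous) treelike_Y (hiso 0) hKY
    refine HasHELP.of_cylinder fun P _ _ _ A hA α b hb => ?_
    obtain ⟨a₀, c₀, ha₀, h00, h01, h0A⟩ := (ih hT fun k => hiso k.succ).exists_cylinder hA
      ((cubeMaps.face X H).comp α) ((cubeMaps.face Y H).comp b)
      (fun p => Subtype.ext (ContinuousMap.ext fun v => by
        simp only [ContinuousMap.comp_apply, hb]
        rfl))
    let B : Set (P × (Fin d → I)) := {z | z.1 ∈ A}
    let lX := cubeMaps.lines X hH.monotone hK1
    let lY := cubeMaps.lines Y hH.monotone hK1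
    let eX := cubeMaps.eval X hT.monotone hK1
    let eY := cubeMaps.eval Y hT.monotone hK1
    obtain ⟨a, ha, ha', c, hc0, hc1, hcA, hc⟩ := HasHELP.exists_lift_over
      (fL := f.onExitPaths (H 0) K) (fS := f.onFixedPoints K) (fun _ => rfl)
      (isRegularFibration_initial (hKX.hasTranslationCharts smooth_X treelike_X))
      (isRegularFibration_initial (hKY.hasTranslationCharts smooth_Y treelike_Y)) hexit hfix
      (A := B) hA.prod_right
      (lX.comp ⟨fun z => (α ⟨z.1.1, z.2⟩, z.1.2), by fun_prop⟩)
      (lY.comp ⟨fun z => (b z.1, z.2), by fun_prop⟩)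
      (fun z => Subtype.ext (ContinuousMap.ext fun u => by
        change (b z.1.1).1 _ = f.toContinuousMap ((α ⟨z.1.1, z.2⟩).1 _)
        rw [hb ⟨z.1.1, z.2⟩]
        rfl))
      (eX.comp ⟨fun z => (a₀ z.1, z.2), by fun_prop⟩)
      (fun z => Subtype.ext (by
        change (a₀ z.1.1).1 z.1.2 = ((cubeMaps.face X H) (α ⟨z.1.1, z.2⟩)).1 z.1.2
        rw [ha₀ ⟨z.1.1, z.2⟩]
        rfl))
      (eY.comp ⟨fun z => (c₀ (z.1.1, z.2), z.1.2), by fun_prop⟩)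
      (fun z => Subtype.ext (by
        change (c₀ (z.1, 0)).1 z.2 = _
        rw [h00]
        rfl))
      (fun z => Subtype.ext (by
        change (c₀ (z.1, 1)).1 z.2 = _
        rw [h01]
        rfl))
      (fun z hz t => Subtype.ext (by
        change (c₀ (z.1, t)).1 z.2 = _
        rw [h0A z.1 hz]
        rfl))
    refine ⟨cubeMaps.ofLines a a₀ fun p v => congrArg Subtype.val (ha' (p, v)),
      cubeMaps.ofLines (c.comp ⟨fun z => ((z.1.1, z.2), z.1.2), by fun_prop⟩) c₀
        fun p v => congrArg Subtype.val (hc ((p.1, v), p.2)),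
      fun p => Subtype.ext (ContinuousMap.ext fun v => ?_),
      fun p => Subtype.ext (ContinuousMap.ext fun v => ?_),
      fun p => Subtype.ext (ContinuousMap.ext fun v => ?_),
      fun p hp t => Subtype.ext (ContinuousMap.ext fun v => ?_)⟩
    · change (a (p, Fin.tail v)).1 (v 0) = _
      rw [ha ⟨(p.1, Fin.tail v), p.2⟩]
      exact congrArg (α p).1 (Fin.cons_self_tail v)
    · change (c ((p, Fin.tail v), 0)).1 (v 0) = _
      rw [hc0]
      rfl
    · change (c ((p, Fin.tail v), 1)).1 (v 0) = _
      rw [hc1]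
      exact congrArg (b p).1 (Fin.cons_self_tail v)
    · change (c ((p, Fin.tail v), t)).1 (v 0) = _
      rw [hcA _ hp]
      exact congrArg (b p).1 (Fin.cons_self_tail v)

theorem IsovariantMap.DulaSchultzConditions.hasHELP_onCubeMaps
    (smooth_X : ∀ g : G, ContMDiff (𝓡 m) (𝓡 m) ∞ (fun x : X => g • x))
    (smooth_Y : ∀ g : G, ContMDiff (𝓡 n) (𝓡 n) ∞ (fun y : Y => g • y))
    (treelike_X : HasTreelikeIsotropy G X) (treelike_Y : HasTreelikeIsotropy G Y)
    {f : IsovariantMap G X Y} (hf : f.DulaSchultzConditions) {d : ℕ}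
    {H : Fin (d + 1) → Subgroup G} (hH : StrictMono H) : HasHELP (f.onCubeMaps H) := by
  by_cases hiso : ∀ k, IsIsotropyGroup G X (H k)
  · exact hf.hasHELP_onCubeMaps_of_isIsotropyGroup smooth_X smooth_Y treelike_X treelike_Y hH hiso
  -- Otherwise there are no maps from the cube to `Y` with these isotropy groups.
  have : IsEmpty (cubeMaps Y H) := ⟨fun γ => hiso fun k => by
    obtain ⟨v, hv⟩ := exists_cubeStabilizer_eq H k
    exact hf.isIsotropyGroup_iff.1 ⟨γ.1 v, (γ.2 v).trans hv⟩⟩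
  intro P _ _ _ A hA α b hb
  have : IsEmpty P := ⟨fun p => isEmptyElim (b p)⟩
  exact ⟨⟨isEmptyElim, continuous_of_const fun x => isEmptyElim x⟩, fun p => isEmptyElim p.1,
    ⟨⟨⟨⟨fun z => isEmptyElim z.2, continuous_of_const fun x => isEmptyElim x.2⟩,
      isEmptyElim, isEmptyElim⟩, fun _ p => isEmptyElim p⟩⟩⟩

end Induction

/-! ### The simplex as a retract of a cube -/

section SimplexCube

variable {n : ℕ}

/-- The embedding of the simplex in the cube by the coordinates `tₙ, …, t₁`. -/
def simplexToCube (n : ℕ) : C(stdSimplex ℝ (Fin (n + 1)), Fin n → I) where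
  toFun x k := ⟨x k.castSucc.rev, x.2.1 _, by
    rw [← x.2.2]
    exact Finset.single_le_sum (fun i _ => x.2.1 i) (Finset.mem_univ _)⟩
  continuous_toFun := by
    refine continuous_pi fun k => Continuous.subtype_mk ?_ _
    exact (continuous_apply _).comp continuous_subtype_val

/-- The coordinates `tₙ, …, t₁` given by a point of the cube, and the coordinate `t₀` which
complements their sum to `1`, or `0` if the sum exceeds `1`. -/
def cubeWeight (v : Fin n → I) : Fin (n + 1) → ℝ :=
  Fin.cons (max 0 (1 - ∑ k, (v k : ℝ))) fun j => (v j.rev : ℝ)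

theorem cubeWeight_nonneg (v : Fin n → I) (i : Fin (n + 1)) : 0 ≤ cubeWeight v i := by
  refine Fin.cases ?_ (fun j => ?_) i
  · exact le_max_left _ _
  · exact (v j.rev).2.1

theorem sum_cubeWeight (v : Fin n → I) : ∑ i, cubeWeight v i =
    max 0 (1 - ∑ k, (v k : ℝ)) + ∑ k, (v k : ℝ) := by
  rw [Fin.sum_univ_succ]
  simp only [cubeWeight, Fin.cons_zero, Fin.cons_succ]
  exact congrArg _ (Equiv.sum_comp Fin.revPerm fun k => (v k : ℝ))

theorem sum_cubeWeight_pos (v : Fin n → I) : 0 < ∑ i, cubeWeight v i := by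
  rw [sum_cubeWeight]
  linarith [le_max_right 0 (1 - ∑ k, (v k : ℝ))]

theorem continuous_cubeWeight : Continuous (cubeWeight (n := n)) := by
  refine continuous_pi fun i => ?_
  refine Fin.cases ?_ (fun j => ?_) i
  · simp only [cubeWeight, Fin.cons_zero]
    fun_prop
  · simp only [cubeWeight, Fin.cons_succ]
    fun_prop

/-- A retraction of the cube onto the simplex which preserves the vanishing of the
coordinates. -/
noncomputable def cubeToSimplex (n : ℕ) : C(Fin n → I, stdSimplex ℝ (Fin (n + 1))) where
  toFun v := ⟨fun i => cubeWeight v i / ∑ j, cubeWeight v j,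
    fun i => div_nonneg (cubeWeight_nonneg v i) (sum_cubeWeight_pos v).le, by
      rw [← Finset.sum_div, div_self (sum_cubeWeight_pos v).ne']⟩
  continuous_toFun := by
    refine Continuous.subtype_mk (continuous_pi fun i => ?_) _
    have := continuous_cubeWeight (n := n)
    exact Continuous.div (by fun_prop) (by fun_prop) fun v => (sum_cubeWeight_pos v).ne'

theorem simplexToCube_cubeToSimplex_eq_zero_iff (v : Fin n → I) (k : Fin n) :
    simplexToCube n (cubeToSimplex n v) k = 0 ↔ v k = 0 := by
  rw [← Set.Icc.coe_eq_zero, ← Set.Icc.coe_eq_zero]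
  change cubeWeight v k.castSucc.rev / _ = 0 ↔ _
  rw [div_eq_zero_iff, or_iff_left (sum_cubeWeight_pos v).ne', Fin.rev_castSucc]
  simp [cubeWeight]

theorem cubeToSimplex_simplexToCube (x : stdSimplex ℝ (Fin (n + 1))) :
    cubeToSimplex n (simplexToCube n x) = x := by
  have hsum : ∑ k, (simplexToCube n x k : ℝ) = 1 - x 0 := by
    rw [eq_sub_iff_add_eq', ← x.2.2, Fin.sum_univ_succ, ← Equiv.sum_comp Fin.revPerm]
    congr 1
    refine Finset.sum_congr rfl fun k _ => ?_
    change x (Fin.rev k).castSucc.rev = x k.succ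
    rw [Fin.rev_castSucc, Fin.rev_rev]
  have hw : cubeWeight (simplexToCube n x) = x := by
    ext i
    refine Fin.cases ?_ (fun j => ?_) i
    · simp only [cubeWeight, Fin.cons_zero, hsum]
      rw [sub_sub_cancel]
      exact max_eq_right (x.2.1 0)
    · simp only [cubeWeight, Fin.cons_succ]
      change x j.rev.castSucc.rev = _
      rw [Fin.rev_castSucc, Fin.rev_rev]
  ext i
  change cubeWeight (simplexToCube n x) i / ∑ j, cubeWeight (simplexToCube n x) j = x i
  rw [hw]
  have : ∑ j, x j = 1 := x.2.2
  rw [this, div_one]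

end SimplexCube

/-! ### Isovariant maps out of linking simplices -/

section LinkingSimplexMaps

variable {G : Type*} [Group G] (H : LTSeries (Subgroup G))

/-- The point of the linking simplex represented by a group element and a point of the
simplex. -/
def LinkingSimplex.mk (z : G × stdSimplex ℝ (Fin (H.length + 1))) : LinkingSimplex H :=
  Quotient.mk (linkingSetoid H) z

theorem LinkingSimplex.mk_eq_smul (g : G) (x : stdSimplex ℝ (Fin (H.length + 1))) :
    LinkingSimplex.mk H (g, x) = g • LinkingSimplex.mk H (1, x) :=
  congrArg (LinkingSimplex.mk H) (Prod.ext (mul_one g).symm rfl)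

theorem LinkingSimplex.mk_eq_mk_iff {g g' : G} {x x' : stdSimplex ℝ (Fin (H.length + 1))} :
    LinkingSimplex.mk H (g, x) = LinkingSimplex.mk H (g', x') ↔
      x = x' ∧ g⁻¹ * g' ∈ cubeStabilizer H.length H (simplexToCube _ x) := by
  refine Quotient.eq.trans (and_congr_right fun _ => ?_)
  rw [mem_cubeStabilizer H.monotone]
  refine exists_congr fun k => and_congr_left fun _ => ⟨fun h j hj => ?_, fun h i hi => ?_⟩
  · refine Subtype.ext (h _ ?_)
    have := Fin.lt_def.1 hj
    simp only [Fin.val_rev, Fin.val_castSucc] at this ⊢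
    omega
  · have h1 := i.2
    have h2 := k.2
    have hj : i = (⟨H.length - i, by omega⟩ : Fin H.length).castSucc.rev := by
      ext
      simp only [Fin.val_rev, Fin.val_castSucc]
      omega
    rw [hj]
    refine congrArg Subtype.val (h ⟨H.length - i, by omega⟩ ?_)
    rw [Fin.lt_def]
    simp only [Fin.val_castSucc]
    omega

theorem LinkingSimplex.stabilizer_mk_one (x : stdSimplex ℝ (Fin (H.length + 1))) :
    MulAction.stabilizer G (LinkingSimplex.mk H (1, x)) =
      cubeStabilizer H.length H (simplexToCube _ x) := by
  ext g
  rw [MulAction.mem_stabilizer_iff, ← LinkingSimplex.mk_eq_smul, LinkingSimplex.mk_eq_mk_iff]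
  simp

variable [TopologicalSpace G]

theorem LinkingSimplex.isQuotientMap_mk : IsQuotientMap (LinkingSimplex.mk H) :=
  isQuotientMap_quotient_mk'

variable (X : Type*) [TopologicalSpace X] [MulAction G X] {Y : Type*} [TopologicalSpace Y]
  [MulAction G Y]

/-- Restriction of isovariant maps out of the linking simplex along the retraction of the cube onto
the simplex. -/
noncomputable def IsovariantMap.toCubeMaps :
    C(IsovariantMap G (LinkingSimplex H) X, cubeMaps X H) where
  toFun φ := ⟨φ.toContinuousMap.comp ⟨fun v => LinkingSimplex.mk H (1, cubeToSimplex _ v),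
      (LinkingSimplex.isQuotientMap_mk H).continuous.comp (by fun_prop)⟩, fun v =>
    (φ.stabilizer_map _).trans ((LinkingSimplex.stabilizer_mk_one H _).trans
      (cubeStabilizer_congr (simplexToCube_cubeToSimplex_eq_zero_iff v)))⟩
  continuous_toFun := Continuous.subtype_mk
    ((ContinuousMap.continuous_precomp _).comp continuous_induced_dom) _

variable {H X}

/-- The equivariant map out of the linking simplex with a given restriction to the simplex. -/
def cubeMaps.extend (γ : cubeMaps X H) : LinkingSimplex H → X :=
  Quotient.lift (fun z => z.1 • γ.1 (simplexToCube _ z.2)) fun z z' h => by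
    obtain ⟨hx, hg⟩ := (LinkingSimplex.mk_eq_mk_iff H (x := z.2) (x' := z'.2)).1 (Quotient.sound h)
    rw [← γ.2, MulAction.mem_stabilizer_iff, mul_smul, inv_smul_eq_iff] at hg
    rw [← hx]
    exact hg.symm

variable [DiscreteTopology G]

theorem cubeMaps.continuous_extend (hc : ∀ g : G, Continuous fun x : X => g • x) {P : Type*}
    [TopologicalSpace P] [LocallyCompactSpace P] (u : C(P, cubeMaps X H)) :
    Continuous fun z : LinkingSimplex H × P => cubeMaps.extend (u z.2) z.1 := by
  refine (LinkingSimplex.isQuotientMap_mk H).continuous_lift_prod_left ?_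
  have h1 : Continuous fun z : G × X => z.1 • z.2 := continuous_prod_of_discrete_left.2 hc
  exact h1.comp (by fun_prop : Continuous fun z : (G × stdSimplex ℝ (Fin (H.length + 1))) × P =>
    (z.1.1, (u z.2).1 (simplexToCube _ z.1.2)))

/-- The isovariant map out of the linking simplex with a given restriction to the simplex. -/
def cubeMaps.toIsovariantMap (hc : ∀ g : G, Continuous fun x : X => g • x) (γ : cubeMaps X H) :
    IsovariantMap G (LinkingSimplex H) X where
  toContinuousMap := ⟨cubeMaps.extend γ, (cubeMaps.continuous_extend hc (ContinuousMap.const Unit γ)).comp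
    (by fun_prop : Continuous fun z : LinkingSimplex H => (z, ()))⟩
  map_smul g := by
    rintro ⟨g', x⟩
    exact mul_smul g g' _
  stabilizer_map := by
    rintro ⟨g, x⟩
    change MulAction.stabilizer G (g • γ.1 (simplexToCube _ x)) =
      MulAction.stabilizer G (LinkingSimplex.mk H (g, x))
    rw [LinkingSimplex.mk_eq_smul, MulAction.stabilizer_smul_eq_stabilizer_map_conj,
      MulAction.stabilizer_smul_eq_stabilizer_map_conj, LinkingSimplex.stabilizer_mk_one, γ.2]

omit [TopologicalSpace G] [DiscreteTopology G] in
theorem IsovariantMap.ext_apply {D : Type*} [TopologicalSpace D] [MulAction G D]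
    {φ ψ : IsovariantMap G D X}
    (h : ∀ z, φ.toContinuousMap z = ψ.toContinuousMap z) : φ = ψ := by
  cases φ
  cases ψ
  congr
  exact ContinuousMap.ext h

theorem cubeMaps.continuous_toIsovariantMap (hc : ∀ g : G, Continuous fun x : X => g • x)
    {P : Type*} [TopologicalSpace P] [LocallyCompactSpace P] (u : C(P, cubeMaps X H)) :
    Continuous fun p => cubeMaps.toIsovariantMap hc (u p) := by
  refine continuous_induced_rng.2 (ContinuousMap.continuous_of_continuous_uncurry _ ?_)
  exact (cubeMaps.continuous_extend hc u).comp continuous_swap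

theorem cubeMaps.toIsovariantMap_toCubeMaps (hc : ∀ g : G, Continuous fun x : X => g • x)
    (φ : IsovariantMap G (LinkingSimplex H) X) :
    cubeMaps.toIsovariantMap hc (φ.toCubeMaps H X) = φ := by
  refine IsovariantMap.ext_apply ?_
  rintro ⟨g, x⟩
  change g • φ.toContinuousMap (LinkingSimplex.mk H (1, cubeToSimplex _ (simplexToCube _ x))) =
    φ.toContinuousMap (LinkingSimplex.mk H (g, x))
  rw [cubeToSimplex_simplexToCube, ← φ.map_smul, ← LinkingSimplex.mk_eq_smul]

/-- Maps of the linking simplex form a retract of the maps from a cube with prescribed isotropy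
groups. -/
theorem IsovariantMap.hasHELP_postcomp (hcX : ∀ g : G, Continuous fun x : X => g • x)
    (hcY : ∀ g : G, Continuous fun y : Y => g • y) {f : IsovariantMap G X Y}
    (h : HasHELP (f.onCubeMaps H)) : HasHELP (f.postcomp (LinkingSimplex H)) := by
  refine h.of_retract (IsovariantMap.toCubeMaps H X) (IsovariantMap.toCubeMaps H Y)
    (cubeMaps.toIsovariantMap hcX) (cubeMaps.toIsovariantMap hcY)
    (fun P _ _ _ u => cubeMaps.continuous_toIsovariantMap hcX u)
    (fun P _ _ _ u => cubeMaps.continuous_toIsovariantMap hcY u) (fun _ => rfl) (fun γ => ?_)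
    (cubeMaps.toIsovariantMap_toCubeMaps hcX) (cubeMaps.toIsovariantMap_toCubeMaps hcY)
  refine IsovariantMap.ext_apply ?_
  rintro ⟨g, x⟩
  exact f.map_smul g _

end LinkingSimplexMaps

/-- An isovariant map between compact smooth `G`-manifolds with treelike isotropy structure which
satisfies the Dula-Schultz conditions is a weak equivalence in the geometric model structure. -/
theorem proposition3p10
    {G : Type*} [Group G] [Finite G] [TopologicalSpace G] [DiscreteTopology G]
    {m n : ℕ}
    {X : Type*} [TopologicalSpace X] [ChartedSpace (EuclideanSpace ℝ (Fin m)) X]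
    [IsManifold (𝓡 m) ∞ X] [T2Space X] [CompactSpace X] [MulAction G X]
    (smooth_X : ∀ g : G, ContMDiff (𝓡 m) (𝓡 m) ∞ (fun x : X => g • x))
    {Y : Type*} [TopologicalSpace Y] [ChartedSpace (EuclideanSpace ℝ (Fin n)) Y]
    [IsManifold (𝓡 n) ∞ Y] [T2Space Y] [CompactSpace Y] [MulAction G Y]
    (smooth_Y : ∀ g : G, ContMDiff (𝓡 n) (𝓡 n) ∞ (fun y : Y => g • y))
    (treelike_X : HasTreelikeIsotropy G X) (treelike_Y : HasTreelikeIsotropy G Y)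
    (f : IsovariantMap G X Y) (hf : f.DulaSchultzConditions) :
    f.IsWeakEquivalence := fun H =>
  (IsovariantMap.hasHELP_postcomp (fun g => (smooth_X g).continuous)
    (fun g => (smooth_Y g).continuous)
    (hf.hasHELP_onCubeMaps smooth_X smooth_Y treelike_X treelike_Y
      H.strictMono)).isWeakHomotopyEquiv
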